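/- Let $\lambda,c_1,c_2>0$, $\alpha>2$, $\ell\in[0,1]$, and let $\Phi_x=\{X_i\}_{i\ge1}\subset\mathbb R^2$ be a (simple) homogeneous Poisson point process of density $\lambda$. Each $X_i$ is the ground projection of a point $U_i=(X_i,H_i)\in\mathbb R^2\times[0,\infty)$ with altitude $H_i=\|X_i\|\tan\Theta_i$, where $\Theta_i\in[0,\pi/2]$ is the elevation angle of $U_i$ seen from the origin (since $H_i<\infty$, $\Theta_i\ne\pi/2$ almost surely). Conditionally on all the points $(U_j)_j$, the links from the origin to the $U_i$ are line-of-sight (LoS) independently of each other, the $i$-th one with probability $\rho(\Theta_i)$, where $\rho(\theta)=\frac{1}{1+c_2e^{-c_1\theta}}$; put $L_i=1$ if the $i$-th link is LoS and $L_i=\ell$ otherwise. The weights $W_i\ge0$ are i.i.d., the sequence $(W_i)_i$ is independent of $(L_j,U_j)_j$, and $\mathbb E[W_i^a]<\infty$ for all $a>0$. Let $$R_\star=\sup_i W_iL_i\|U_i\|^{-\alpha},$$ and let $W,\Theta,H$ denote random variables distributed as $W_i,\Theta_i,H_i$. (i) (APIL scenario) If the $\Theta_i$ are i.i.d. and the sequence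 $(\Theta_i)_i$ is independent of $(\|X_j\|)_j$, then almost surely the supremum is finite and attained, so that $R_\star=\max_i W_iL_i\|U_i\|^{-\alpha}$, and for every $r>0$ $$\mathbb P[R_\star\le r]=\exp\left(-\pi\lambda\,\mathbb E\left[W^{2/\alpha}\right]\omega\, r^{-2/\alpha}\right),\qquad \omega=\mathbb E\left\{\cos^2(\Theta)\left[\rho(\Theta)\left(1-\ell^{2/\alpha}\right)+\ell^{2/\alpha}\right]\right\}.$$ (ii) (APDL scenario) If the $H_i$ are i.i.d., the sequence $(H_i)_i$ is independent of $(\|X_j\|)_j$, and $\Theta_i=\tan^{-1}(H_i/\|X_i\|)$, then almost surely the supremum is finite and attained, and for every $r>0$ $$\mathbb P[R_\star\le r]=\exp\left(-\pi\lambda\,\Omega(r)\right),$$ $$\Omega(r)=\int_0^\infty\mathbb E_H\left\{\rho(\Theta_z)\,F^c_W\!\left(r(z+H^2)^{\alpha/2}\right)+[1-\rho(\Theta_z)]\,F^c_W\!\left(\tfrac r\ell (z+H^2)^{\alpha/2}\right)\right\}dz<\infty,$$ where $\Theta_z=\tan^{-1}(H/\sqrt z)$, $F^c_W(x)=\mathbb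 P[W>x]$, and for $\ell=0$ the term $F^c_W(\tfrac r\ell\,\cdot)$ is read as $F^c_W(\infty)=0$. -/

import Mathlib

open MeasureTheory ProbabilityTheory
open scoped NNReal ENNReal

noncomputable section

/-- The ground plane `ℝ²` with its Euclidean norm. -/
abbrev Plane : Type := EuclideanSpace ℝ (Fin 2)

/-- The space `ℝ² × ℝ` (ground projection, altitude) with its Euclidean norm. -/
abbrev Space : Type := WithLp 2 (Plane × ℝ)

/-- The number of points of the sequence `x` that lie in `B`. -/
def pointCount (x : ℕ → Plane) (B : Set Plane) : ℕ∞ := {i | x i ∈ B}.encard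

/-- The random points `X 0, X 1, …` enumerate a (simple) homogeneous Poisson point process of
density `lam` on the plane: almost surely they are pairwise distinct, the number of points in a
Borel set `B` of finite area `|B|` is Poisson distributed with mean `lam * |B|`, and the numbers of
points in finitely many pairwise disjoint Borel sets are independent. -/
structure IsHomogeneousPPP {Ω : Type*} [MeasurableSpace Ω] (μ : Measure Ω) (lam : ℝ)
    (X : ℕ → Ω → Plane) : Prop where
  measurable : ∀ i, Measurable (X i)
  simple : ∀ᵐ ω ∂μ, Function.Injective (fun i => X i ω)
  count_law : ∀ B : Set Plane, MeasurableSet B → volume B ≠ ∞ →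
    HasLaw (fun ω => pointCount (fun i => X i ω) B)
      ((poissonMeasure (Real.toNNReal lam * (volume B).toNNReal)).map (Nat.cast : ℕ → ℕ∞)) μ
  count_indep : ∀ (n : ℕ) (B : Fin n → Set Plane), (∀ j, MeasurableSet (B j)) →
    Pairwise (fun j k => Disjoint (B j) (B k)) →
    iIndepFun (fun j ω => pointCount (fun i => X i ω) (B j)) μ

/-- The random variables `Z 0, Z 1, …` are independent and identically distributed. -/
def IsIID {Ω : Type*} [MeasurableSpace Ω] (μ : Measure Ω) (Z : ℕ → Ω → ℝ) : Prop :=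
  iIndepFun Z μ ∧ ∀ i, IdentDistrib (Z i) (Z 0) μ μ

/-- The probability that a link of elevation angle `θ` is line-of-sight. -/
def losProb (c₁ c₂ θ : ℝ) : ℝ := 1 / (1 + c₂ * Real.exp (-c₁ * θ))

/-- The 3D point `U i = (X i, H i)`. -/
def point3D {Ω : Type*} (X : ℕ → Ω → Plane) (H : ℕ → Ω → ℝ) (i : ℕ) (ω : Ω) : Space :=
  WithLp.toLp 2 (X i ω, H i ω)

open Classical in
/-- The factor `L i`: `1` if the link to point `i` is line-of-sight (the event `los i`), and the
attenuation `ell` otherwise. -/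
def losFactor {Ω : Type*} (ell : ℝ) (los : ℕ → Set Ω) (i : ℕ) (ω : Ω) : ℝ :=
  if ω ∈ los i then 1 else ell

/-- The weighted gain `W i * L i * ‖U i‖ ^ (-α)`. -/
def gain {Ω : Type*} (α ell : ℝ) (X : ℕ → Ω → Plane) (H : ℕ → Ω → ℝ) (los : ℕ → Set Ω)
    (W : ℕ → Ω → ℝ) (i : ℕ) (ω : Ω) : ℝ :=
  W i ω * losFactor ell los i ω * ‖point3D X H i ω‖ ^ (-α)

/-- `R⋆`, the supremum of all weighted gains (shown to be an almost sure maximum as part of the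
theorem). -/
def Rstar {Ω : Type*} (α ell : ℝ) (X : ℕ → Ω → Plane) (H : ℕ → Ω → ℝ) (los : ℕ → Set Ω)
    (W : ℕ → Ω → ℝ) (ω : Ω) : ℝ :=
  ⨆ i, gain α ell X H los W i ω

/-- The σ-algebra generated by all the points `U i`. -/
@[reducible]
def sigmaU {Ω : Type*} (X : ℕ → Ω → Plane) (H : ℕ → Ω → ℝ) : MeasurableSpace Ω :=
  MeasurableSpace.comap (fun ω i => point3D X H i ω) inferInstance

/-- The 3D point process with its line-of-sight events and weights, common to both scenarios.
`X` are the projections, `H` the altitudes, `Θ` the elevation angles, `los i` the event that the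
link from the origin to the `i`-th point is line-of-sight, and `W` the weights. -/
structure IsAerialModel {Ω : Type*} [MeasurableSpace Ω] (μ : Measure Ω) (lam c₁ c₂ ell : ℝ)
    (X : ℕ → Ω → Plane) (H Θ : ℕ → Ω → ℝ) (los : ℕ → Set Ω) (W : ℕ → Ω → ℝ) : Prop where
  ppp : IsHomogeneousPPP μ lam X
  measurable_altitude : ∀ i, Measurable (H i)
  measurable_angle : ∀ i, Measurable (Θ i)
  measurable_los : ∀ i, MeasurableSet (los i)
  measurable_weight : ∀ i, Measurable (W i)
  altitude_nonneg : ∀ i, ∀ᵐ ω ∂μ, 0 ≤ H i ω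
  angle_mem : ∀ i, ∀ᵐ ω ∂μ, Θ i ω ∈ Set.Icc 0 (Real.pi / 2)
  /-- `H = ‖X‖ tan Θ` with the denominator `cos Θ` cleared; as `X ≠ 0` almost surely, this forces
  `Θ ≠ π / 2` almost surely. -/
  altitude_eq : ∀ i, ∀ᵐ ω ∂μ, H i ω * Real.cos (Θ i ω) = ‖X i ω‖ * Real.sin (Θ i ω)
  /-- Given all the points, the links are line-of-sight independently of each other, the `i`-th one
  with probability `losProb c₁ c₂ (Θ i)`. -/
  los_law : ∀ s : Finset ℕ,
    μ[(⋂ i ∈ s, los i).indicator (fun _ => (1 : ℝ)) | sigmaU X H]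
      =ᵐ[μ] fun ω => ∏ i ∈ s, losProb c₁ c₂ (Θ i ω)
  weight_nonneg : ∀ i, ∀ᵐ ω ∂μ, 0 ≤ W i ω
  weight_iid : IsIID μ W
  /-- The weights are independent of all the points and line-of-sight factors. -/
  weight_indep : IndepFun (fun ω i => W i ω)
    (fun ω i => (losFactor ell los i ω, point3D X H i ω)) μ
  weight_moments : ∀ a : ℝ, 0 < a → ∀ i, Integrable (fun ω => W i ω ^ a) μ

/-- Angle-projection-independent locating: the elevation angles are i.i.d. and independent of the
distances of the projections. -/
structure IsAPIL {Ω : Type*} [MeasurableSpace Ω] (μ : Measure Ω)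
    (X : ℕ → Ω → Plane) (Θ : ℕ → Ω → ℝ) : Prop where
  angle_iid : IsIID μ Θ
  angle_indep : IndepFun (fun ω i => Θ i ω) (fun ω i => ‖X i ω‖) μ

/-- Angle-projection-dependent locating: the altitudes are i.i.d. and independent of the distances
of the projections, and they determine the elevation angles. -/
structure IsAPDL {Ω : Type*} [MeasurableSpace Ω] (μ : Measure Ω)
    (X : ℕ → Ω → Plane) (H Θ : ℕ → Ω → ℝ) : Prop where
  altitude_iid : IsIID μ H
  altitude_indep : IndepFun (fun ω i => H i ω) (fun ω i => ‖X i ω‖) μ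
  angle_eq : ∀ i, ∀ᵐ ω ∂μ, Θ i ω = Real.arctan (H i ω / ‖X i ω‖)

/-- The complementary CDF of a real random variable. -/
def ccdf {Ω : Type*} [MeasurableSpace Ω] (μ : Measure Ω) (Z : Ω → ℝ) (x : ℝ) : ℝ :=
  μ.real {ω | x < Z ω}

/-- `ω = E{cos²Θ [ρ(Θ)(1 - ℓ^(2/α)) + ℓ^(2/α)]}` for an angle `T` with the law of `Θ`. -/
def omegaConst {Ω : Type*} [MeasurableSpace Ω] (μ : Measure Ω) (α c₁ c₂ ell : ℝ)
    (T : Ω → ℝ) : ℝ :=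
  ∫ ω, Real.cos (T ω) ^ 2 *
    (losProb c₁ c₂ (T ω) * (1 - ell ^ (2 / α)) + ell ^ (2 / α)) ∂μ

/-- The integrand (in `z`) of `Ω(r)`: the expectation over the altitude `h` of
`ρ(Θ) F^c_W(r (z+h²)^(α/2)) + (1 - ρ(Θ)) F^c_W((r/ℓ) (z+h²)^(α/2))` with `Θ = arctan (h / √z)`.
For `ℓ = 0` the argument `r/ℓ` is infinite, and the second CCDF is `0`. -/
def OmegaIntegrand {Ω : Type*} [MeasurableSpace Ω] (μ : Measure Ω) (α c₁ c₂ ell : ℝ)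
    (V h : Ω → ℝ) (r z : ℝ) : ℝ :=
  ∫ ω, (losProb c₁ c₂ (Real.arctan (h ω / √z)) * ccdf μ V (r * (z + h ω ^ 2) ^ (α / 2)) +
    (1 - losProb c₁ c₂ (Real.arctan (h ω / √z))) *
      (if ell = 0 then 0 else ccdf μ V (r / ell * (z + h ω ^ 2) ^ (α / 2)))) ∂μ

/-- `Ω(r)`, for a weight `V` with the law of `W` and an altitude `h` with the law of `H`. -/
def OmegaFun {Ω : Type*} [MeasurableSpace Ω] (μ : Measure Ω) (α c₁ c₂ ell : ℝ)
    (V h : Ω → ℝ) (r : ℝ) : ℝ :=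
  ∫ z in Set.Ioi (0 : ℝ), OmegaIntegrand μ α c₁ c₂ ell V h r z

end

/-! In both scenarios there are i.i.d. marks (angles, respectively altitudes), independent of the
ground distances, which together with these distances determine the angle and the length of every
link. Averaging in turn over the weights, the line-of-sight events and the marks shows that the
first `m` gains are all at most `r` with probability `E ∏_{i<m} (1 - p_r(‖X_i‖))`, where `p_r` is
`markedExceedProb`.

As `m → ∞`, the probability generating functional of the Poisson process (`iInf_lintegral_prod`)
gives the limit `exp(-lam ∫ p_r(‖x‖) dx)`, and the substitution `z = ‖x‖²` turns the exponent into
`-π lam ∫₀^∞ p_r(√z) dz`. If this integral is finite, Campbell's theorem and Borel–Cantelli leave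
only finitely many gains above each `r > 0`, so the supremum is attained. All this is
`isGreatest_and_cdf_of_marks`.

The scenarios differ only in the last integral. With angles as marks the link length is `√z / cos
Θ`, so for an attenuation `k` the exceedance set in `z` is an interval of length `cos²Θ (W k /
r)^(2/α)`, and the integral is explicit. With altitudes as marks the link length is at least `√z`,
so finiteness follows by comparison, and the integrand is rewritten through the tail of `W`. -/

/-! ### Mean and generating function of the Poisson distribution. -/

lemma lintegral_poissonMeasure (r : ℝ≥0) (f : ℕ → ℝ≥0∞) :
    ∫⁻ n, f n ∂(poissonMeasure r) =
      ∑' n : ℕ, ENNReal.ofReal (Real.exp (-r) * r ^ n / (n.factorial)) * f n := by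
  rw [poissonMeasure, lintegral_sum_measure]
  simp [lintegral_smul_measure, lintegral_dirac]

lemma lintegral_id_poissonMeasure (r : ℝ≥0) : ∫⁻ n, (n : ℝ≥0∞) ∂(poissonMeasure r) = r := by
  rw [lintegral_poissonMeasure, tsum_eq_zero_add' ENNReal.summable]
  have h : ∀ n : ℕ, ENNReal.ofReal (Real.exp (-r) * r ^ (n + 1) / ((n + 1).factorial)) *
      ((n + 1 : ℕ) : ℝ≥0∞) =
      r * ENNReal.ofReal (Real.exp (-r) * r ^ n / (n.factorial)) := by
    intro n
    rw [← ENNReal.ofReal_natCast, ← ENNReal.ofReal_coe_nnreal,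
      ← ENNReal.ofReal_mul (by positivity), ← ENNReal.ofReal_mul (by positivity)]
    congr 1
    rw [Nat.factorial_succ]
    push_cast
    have := n.factorial_ne_zero
    field_simp
    ring
  simp_rw [h]
  rw [ENNReal.tsum_mul_left, ← ENNReal.ofReal_tsum_of_nonneg (fun n => by positivity)
    (hasSum_one_poissonMeasure r).summable, (hasSum_one_poissonMeasure r).tsum_eq]
  simp

/-- This is the exponential series at `r (1 - c)` times `exp (-r)`. The bound `c ≤ 1` makes the
truncated subtraction agree with the real one. -/
lemma lintegral_pow_poissonMeasure (r : ℝ≥0) {c : ℝ≥0∞} (hc : c ≤ 1) :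
    ∫⁻ n, (1 - c) ^ n ∂(poissonMeasure r) = ENNReal.ofReal (Real.exp (-(r * c.toReal))) := by
  have hct : c ≠ ∞ := ne_top_of_le_ne_top ENNReal.one_ne_top hc
  have hc' : c.toReal ≤ 1 := by simpa using ENNReal.toReal_mono ENNReal.one_ne_top hc
  have hs : (1 - c) = ENNReal.ofReal (1 - c.toReal) := by
    rw [ENNReal.ofReal_sub _ ENNReal.toReal_nonneg, ENNReal.ofReal_toReal hct, ENNReal.ofReal_one]
  have h0 : 0 ≤ 1 - c.toReal := by linarith
  have hsum : HasSum (fun n : ℕ => Real.exp (-r) * r ^ n / (n.factorial) * (1 - c.toReal) ^ n)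
      (Real.exp (-(r * c.toReal))) := by
    have h := (NormedSpace.expSeries_div_hasSum_exp ((r : ℝ) * (1 - c.toReal))).mul_left
      (Real.exp (-r))
    rw [← Real.exp_eq_exp_ℝ, ← Real.exp_add] at h
    have e : -(r : ℝ) + r * (1 - c.toReal) = -(r * c.toReal) := by ring
    rw [e] at h
    refine h.congr_fun fun n => ?_
    rw [mul_pow]; ring
  rw [lintegral_poissonMeasure, ← hsum.tsum_eq,
    ENNReal.ofReal_tsum_of_nonneg (fun n => by positivity) hsum.summable]
  refine tsum_congr fun n => ?_
  rw [hs, ← ENNReal.ofReal_pow h0, ← ENNReal.ofReal_mul (by positivity)]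

/-! ### Counts and intensity measure of the Poisson process. -/

section PoissonProcess

variable {Ω : Type*} [MeasurableSpace Ω] {μ : Measure Ω} {lam : ℝ} {X : ℕ → Ω → Plane}

lemma measurable_pointCount (hX : ∀ i, Measurable (X i)) {B : Set Plane} (hB : MeasurableSet B) :
    Measurable (fun ω => pointCount (fun i => X i ω) B) := by
  have key : ∀ n : ℕ, MeasurableSet {ω | pointCount (fun i => X i ω) B = n} := by
    intro n
    -- A count equal to `n` means that the indices hit are exactly some `n`-element finite set, and
    -- there are only countably many such sets.
    have : {ω | pointCount (fun i => X i ω) B = n} =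
        ⋃ t ∈ {t : Finset ℕ | t.card = n}, ⋂ i, {ω | X i ω ∈ B ↔ i ∈ t} := by
      ext ω
      simp only [Set.mem_ofPred_eq, Set.mem_iUnion, Set.mem_iInter, exists_prop, pointCount]
      constructor
      · intro h
        have hfin : {i | X i ω ∈ B}.Finite := Set.finite_of_encard_eq_coe h
        refine ⟨hfin.toFinset, ?_, by simp⟩
        rw [hfin.encard_eq_coe_toFinset_card] at h
        exact_mod_cast h
      · rintro ⟨t, ht, hi⟩
        have : {i | X i ω ∈ B} = t := by ext i; simp [hi i]
        rw [this, Set.encard_coe_eq_coe_finsetCard, ht]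
    rw [this]
    refine MeasurableSet.biUnion (Set.to_countable _) fun t _ => MeasurableSet.iInter fun i => ?_
    by_cases hi : i ∈ t
    · simp only [hi, iff_true]; exact hX i hB
    · simp only [hi, iff_false]; exact (hX i hB).compl
  refine measurable_to_countable' fun n => ?_
  induction n using ENat.recTopCoe with
  | top =>
    have : (fun ω => pointCount (fun i => X i ω) B) ⁻¹' {⊤} =
        (⋃ n : ℕ, {ω | pointCount (fun i => X i ω) B = n})ᶜ := by
      ext ω
      simp only [Set.mem_preimage, Set.mem_singleton_iff, Set.mem_compl_iff, Set.mem_iUnion,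
        Set.mem_ofPred_eq, not_exists]
      rw [← not_iff_not, ← ne_eq, ENat.ne_top_iff_exists]
      push Not
      simp [eq_comm]
    rw [this]
    exact (MeasurableSet.iUnion key).compl
  | coe n => exact key n

namespace IsHomogeneousPPP

lemma ae_pointCount_ne_top (hX : IsHomogeneousPPP μ lam X) {B : Set Plane}
    (hB : MeasurableSet B) (hv : volume B ≠ ∞) :
    ∀ᵐ ω ∂μ, pointCount (fun i => X i ω) B ≠ ⊤ := by
  have hl := hX.count_law B hB hv
  have h2 : ∀ᵐ n ∂(μ.map fun ω => pointCount (fun i => X i ω) B), n ≠ ⊤ := by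
    rw [hl.map_eq, ae_map_iff .of_discrete (by measurability)]
    exact .of_forall fun n => ENat.natCast_ne_top n
  exact ae_of_ae_map hl.aemeasurable h2

lemma lintegral_comp_pointCount (hX : IsHomogeneousPPP μ lam X) {B : Set Plane}
    (hB : MeasurableSet B) (hv : volume B ≠ ∞) (f : ℕ∞ → ℝ≥0∞) :
    ∫⁻ ω, f (pointCount (fun i => X i ω) B) ∂μ =
      ∫⁻ n : ℕ, f n ∂(poissonMeasure (Real.toNNReal lam * (volume B).toNNReal)) := by
  have hl := hX.count_law B hB hv
  rw [← lintegral_map' (f := f) (Measurable.of_discrete).aemeasurable hl.aemeasurable, hl.map_eq,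
    lintegral_map .of_discrete .of_discrete]

lemma tsum_measure_preimage_of_ne_top (hX : IsHomogeneousPPP μ lam X) {B : Set Plane}
    (hB : MeasurableSet B) (hv : volume B ≠ ∞) :
    ∑' i, μ (X i ⁻¹' B) = ENNReal.ofReal lam * volume B := by
  have h1 : ∀ i, μ (X i ⁻¹' B) = ∫⁻ ω, (X i ⁻¹' B).indicator 1 ω ∂μ := fun i =>
    (lintegral_indicator_one (hX.measurable i hB)).symm
  simp_rw [h1]
  rw [← lintegral_tsum fun i =>
    (measurable_one.indicator (hX.measurable i hB)).aemeasurable]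
  have h2 : ∫⁻ ω, ∑' i, (X i ⁻¹' B).indicator (1 : Ω → ℝ≥0∞) ω ∂μ =
      ∫⁻ ω, ((pointCount (fun i => X i ω) B).toENNReal) ∂μ := by
    refine lintegral_congr fun ω => ?_
    rw [pointCount, ← ENNReal.tsum_set_one, tsum_subtype _ (fun _ => (1 : ℝ≥0∞))]
    rfl
  rw [h2, hX.lintegral_comp_pointCount hB hv (fun n => n.toENNReal)]
  simp only [ENat.toENNReal_coe, lintegral_id_poissonMeasure]
  rw [ENNReal.coe_mul, ENNReal.coe_toNNReal hv]
  rfl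

/-- **Campbell's theorem**: the intensity measure of the process is `lam` times the area. -/
lemma tsum_measure_preimage (hX : IsHomogeneousPPP μ lam X) {B : Set Plane}
    (hB : MeasurableSet B) :
    ∑' i, μ (X i ⁻¹' B) = ENNReal.ofReal lam * volume B := by
  have hsum : ∀ {C : Set Plane}, MeasurableSet C →
      Measure.sum (fun i => μ.map (X i)) C = ∑' i, μ (X i ⁻¹' C) := fun hC => by
    rw [Measure.sum_apply _ hC]
    exact tsum_congr fun i => Measure.map_apply (hX.measurable i) hC
  -- The law of the counts is prescribed only for finite area, so `B` is exhausted by its bounded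
  -- parts.
  have hU : ⋃ n : ℕ, B ∩ Metric.ball (0 : Plane) n = B := by
    rw [← Set.inter_iUnion, Metric.iUnion_ball_nat, Set.inter_univ]
  have hmono : Monotone fun n : ℕ => B ∩ Metric.ball (0 : Plane) n := fun m n hmn =>
    Set.inter_subset_inter_right _ (Metric.ball_subset_ball (by exact_mod_cast hmn))
  rw [← hsum hB, ← hU, hmono.measure_iUnion, hmono.measure_iUnion, ENNReal.mul_iSup]
  refine iSup_congr fun n => ?_
  have hm : MeasurableSet (B ∩ Metric.ball (0 : Plane) n) := hB.inter Metric.isOpen_ball.measurableSet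
  rw [hsum hm, hX.tsum_measure_preimage_of_ne_top hm]
  exact ((measure_mono Set.inter_subset_right).trans_lt measure_ball_lt_top).ne

/-- The model does not fix the law of an individual `X i`, since the enumeration is arbitrary. Only
the sum of these laws is known. -/
lemma sum_map_eq (hX : IsHomogeneousPPP μ lam X) :
    Measure.sum (fun i => μ.map (X i)) = ENNReal.ofReal lam • volume := by
  ext B hB
  rw [Measure.sum_apply _ hB, Measure.smul_apply, smul_eq_mul, ← hX.tsum_measure_preimage hB]
  exact tsum_congr fun i => Measure.map_apply (hX.measurable i) hB

lemma tsum_lintegral (hX : IsHomogeneousPPP μ lam X) {h : Plane → ℝ≥0∞} (hh : Measurable h) :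
    ∑' i, ∫⁻ ω, h (X i ω) ∂μ = ENNReal.ofReal lam * ∫⁻ x, h x := by
  rw [← smul_eq_mul, ← lintegral_smul_measure, ← hX.sum_map_eq, lintegral_sum_measure]
  exact tsum_congr fun i => (lintegral_map hh (hX.measurable i)).symm

lemma ae_ne_zero (hX : IsHomogeneousPPP μ lam X) (i : ℕ) : ∀ᵐ ω ∂μ, X i ω ≠ 0 := by
  have h := hX.tsum_measure_preimage (measurableSet_singleton 0)
  rw [measure_singleton, mul_zero, ENNReal.tsum_eq_zero] at h
  rw [ae_iff]
  simp only [not_not]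
  exact h i

end IsHomogeneousPPP

/-! ### The probability generating functional. -/

lemma antitone_prod_range_one_sub (f : ℕ → ℝ≥0∞) :
    Antitone fun m : ℕ => ∏ i ∈ Finset.range m, (1 - f i) := fun _ _ hmn =>
  Finset.prod_le_prod_of_subset_of_le_one' (Finset.range_mono hmn) fun _ _ _ => tsub_le_self

/-- If only finitely many factors differ from one, the infimum of the partial products
is a finite product over the nonzero values. -/
lemma iInf_prod_one_sub_simpleFunc (h : SimpleFunc Plane ℝ≥0∞) (x : ℕ → Plane)
    (hfin : ∀ c ≠ 0, pointCount x (h ⁻¹' {c}) ≠ ⊤) :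
    ⨅ m : ℕ, ∏ i ∈ Finset.range m, (1 - h (x i)) =
      ∏ c ∈ h.range with c ≠ 0, (1 - c) ^ (pointCount x (h ⁻¹' {c})).toNat := by
  classical
  have hS : {i | h (x i) ≠ 0}.Finite := by
    have : {i | h (x i) ≠ 0} ⊆ ⋃ c ∈ (h.range.filter (· ≠ 0) : Finset _), {i | x i ∈ h ⁻¹' {c}} := by
      intro i hi
      simp only [Set.mem_iUnion]
      exact ⟨h (x i), by simpa using hi, by simp⟩
    refine Set.Finite.subset (Set.Finite.biUnion (Finset.finite_toSet _) fun c hc => ?_) this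
    exact Set.encard_ne_top_iff.mp (hfin c (by simp at hc; exact hc.2))
  have hanti := antitone_prod_range_one_sub fun i => h (x i)
  have hprod : ∏ i ∈ hS.toFinset, (1 - h (x i)) =
      ∏ c ∈ h.range with c ≠ 0, (1 - c) ^ (pointCount x (h ⁻¹' {c})).toNat := by
    rw [← Finset.prod_fiberwise_of_maps_to (g := fun i => h (x i))
      (t := h.range.filter (· ≠ 0)) (by intro i hi; simpa using hi)]
    refine Finset.prod_congr rfl fun c hc => ?_
    simp only [Finset.mem_filter] at hc
    rw [Finset.prod_congr rfl (g := fun _ => 1 - c)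
      (fun i hi => by rw [(Finset.mem_filter.mp hi).2]), Finset.prod_const]
    congr 1
    rw [pointCount, ← Set.ncard_def, ← Set.ncard_coe_finset]
    congr 1
    ext i
    simp only [Set.Finite.mem_toFinset, Finset.coe_filter, Set.mem_ofPred_eq, Set.mem_preimage,
      Set.mem_singleton_iff]
    exact ⟨fun hi => hi.2, fun hi => ⟨hi ▸ hc.2, hi⟩⟩
  rw [← hprod]
  -- From `M` on, every new factor is one, so the decreasing partial products are constant.
  obtain ⟨M, hM⟩ := hS.toFinset.exists_nat_subset_range
  have heq : ∏ i ∈ Finset.range M, (1 - h (x i)) = ∏ i ∈ hS.toFinset, (1 - h (x i)) := by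
    refine (Finset.prod_subset hM fun i _ hi => ?_).symm
    have : h (x i) = 0 := by simpa using hi
    simp [this]
  refine le_antisymm ((iInf_le _ M).trans heq.le) (le_iInf fun m => ?_)
  rcases le_total m M with hmM | hmM
  · rw [← heq]; exact hanti hmM
  · refine le_of_eq (Finset.prod_subset (hM.trans (Finset.range_mono hmM)) fun i _ hi => ?_)
    have : h (x i) = 0 := by simpa using hi
    simp [this]

lemma prod_one_sub_le_one (s : Finset ℕ) (f : ℕ → ℝ≥0∞) : ∏ i ∈ s, (1 - f i) ≤ 1 :=
  Finset.prod_le_one' fun _ _ => tsub_le_self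

namespace IsHomogeneousPPP

lemma iInf_lintegral_prod_simpleFunc [IsProbabilityMeasure μ] (hX : IsHomogeneousPPP μ lam X)
    (hlam : 0 < lam)
    (h : SimpleFunc Plane ℝ≥0∞) (h1 : ∀ x, h x ≤ 1) (hint : ∫⁻ x, h x ≠ ∞) :
    ⨅ m : ℕ, ∫⁻ ω, ∏ i ∈ Finset.range m, (1 - h (X i ω)) ∂μ =
      ENNReal.ofReal (Real.exp (-(lam * (∫⁻ x, h x).toReal))) := by
  classical
  have hmeas : ∀ i, Measurable fun ω => 1 - h (X i ω) := fun i =>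
    (h.measurable.comp (hX.measurable i)).const_sub 1
  have hms : ∀ c, MeasurableSet (h ⁻¹' {c}) := fun c => h.measurableSet_fiber c
  -- Integrability makes each level set of a nonzero value finite in area, so its count is Poisson.
  have hfms : h.FinMeasSupp volume := by
    refine SimpleFunc.FinMeasSupp.of_lintegral_ne_top ?_
    rwa [← SimpleFunc.lintegral_eq_lintegral]
  have hvol : ∀ c ≠ 0, volume (h ⁻¹' {c}) ≠ ∞ := fun c hc =>
    ((SimpleFunc.finMeasSupp_iff.mp hfms) c hc).ne
  rw [← lintegral_iInf (fun m => Finset.measurable_prod _ fun i _ => hmeas i)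
    (fun m n hmn ω => antitone_prod_range_one_sub (fun i => h (X i ω)) hmn)
    (by simp)]
  set S : Finset ℝ≥0∞ := h.range.filter (· ≠ 0) with hSdef
  have hfin : ∀ᵐ ω ∂μ, ∀ c ∈ S, pointCount (fun i => X i ω) (h ⁻¹' {c}) ≠ ⊤ := by
    rw [Filter.eventually_all_finset]
    intro c hc
    exact hX.ae_pointCount_ne_top (hms c) (hvol c (by simp [hSdef] at hc; exact hc.2))
  have hae : ∀ᵐ ω ∂μ, ⨅ m : ℕ, ∏ i ∈ Finset.range m, (1 - h (X i ω)) =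
      ∏ c ∈ S, (1 - c) ^ (pointCount (fun i => X i ω) (h ⁻¹' {c})).toNat := by
    filter_upwards [hfin] with ω hω
    refine iInf_prod_one_sub_simpleFunc h (fun i => X i ω) fun c hc => ?_
    by_cases hcr : c ∈ h.range
    · exact hω c (by simp [hSdef, hc]; simpa using hcr)
    · have : h ⁻¹' {c} = ∅ := by
        rwa [SimpleFunc.preimage_eq_empty_iff]
      simp [this, pointCount]
  rw [lintegral_congr_ae hae]
  -- Level sets of distinct values are disjoint, so the expectation of the product splits into
  -- Poisson generating functions.
  have hind : iIndepFun (fun (c : S) ω => pointCount (fun i => X i ω) (h ⁻¹' {(c : ℝ≥0∞)})) μ := by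
    let e := S.equivFin
    have := hX.count_indep S.card (fun j => h ⁻¹' {((e.symm j : S) : ℝ≥0∞)}) (fun j => hms _)
      (fun j k hjk => by
        refine Disjoint.preimage _ (Set.disjoint_singleton.mpr fun hh => hjk ?_)
        exact e.symm.injective (Subtype.ext hh))
    have h2 := this.precomp e.injective
    convert h2 using 2 with c
    simp
  have hind2 := hind.comp (fun c n => (1 - (c : ℝ≥0∞)) ^ n.toNat) (fun c => .of_discrete)
  have hprod := lintegral_prod_eq_prod_lintegral_of_indepFun Finset.univ _ hind2
    (fun c => (Measurable.of_discrete (f := fun n : ℕ∞ => (1 - (c : ℝ≥0∞)) ^ n.toNat)).comp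
      (measurable_pointCount hX.measurable (hms c)))
  simp only [Function.comp_apply] at hprod
  have e1 : ∀ ω, ∏ c ∈ S, (1 - c) ^ (pointCount (fun i => X i ω) (h ⁻¹' {c})).toNat =
      ∏ c : S, (1 - (c : ℝ≥0∞)) ^ (pointCount (fun i => X i ω) (h ⁻¹' {(c : ℝ≥0∞)})).toNat :=
    fun ω => (Finset.prod_coe_sort S fun c =>
      (1 - c) ^ (pointCount (fun i => X i ω) (h ⁻¹' {c})).toNat).symm
  simp_rw [e1]
  rw [hprod]
  have hS1 : ∀ c ∈ S, c ≠ 0 ∧ c ≤ 1 := by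
    intro c hc
    simp only [hSdef, Finset.mem_filter, SimpleFunc.mem_range, Set.mem_range] at hc
    obtain ⟨⟨x, rfl⟩, h0⟩ := hc
    exact ⟨h0, h1 x⟩
  have e2 : ∀ c : S, ∫⁻ ω, (1 - (c : ℝ≥0∞)) ^
      (pointCount (fun i => X i ω) (h ⁻¹' {(c : ℝ≥0∞)})).toNat ∂μ =
      ENNReal.ofReal (Real.exp (-(lam * (volume (h ⁻¹' {(c : ℝ≥0∞)})).toReal * (c : ℝ≥0∞).toReal))) := by
    intro c
    rw [hX.lintegral_comp_pointCount (hms c) (hvol c (hS1 c c.2).1)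
      (fun n => (1 - (c : ℝ≥0∞)) ^ n.toNat)]
    simp only [ENat.toNat_natCast]
    rw [lintegral_pow_poissonMeasure _ (hS1 c c.2).2]
    simp [hlam.le, ENNReal.toReal]
  simp_rw [e2]
  rw [← ENNReal.ofReal_prod_of_nonneg (fun c _ => (Real.exp_pos _).le), ← Real.exp_sum,
    Finset.sum_coe_sort S (fun c => -(lam * (volume (h ⁻¹' {c})).toReal * c.toReal)),
    SimpleFunc.lintegral_eq_lintegral h volume, SimpleFunc.lintegral, ENNReal.toReal_sum]
  · congr 2
    rw [Finset.mul_sum, ← Finset.sum_neg_distrib, hSdef, Finset.sum_filter]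
    refine Finset.sum_congr rfl fun c _ => ?_
    by_cases hc : c = 0
    · simp [hc]
    · simp [hc]; ring
  · intro c hc
    by_cases h0 : c = 0
    · simp [h0]
    · refine ENNReal.mul_ne_top (ne_top_of_le_ne_top ENNReal.one_ne_top
        (hS1 c (by simp only [hSdef, Finset.mem_filter]; exact ⟨hc, h0⟩)).2) (hvol c h0)

/-- The probability generating functional of a homogeneous Poisson process. -/
lemma iInf_lintegral_prod [IsProbabilityMeasure μ] (hX : IsHomogeneousPPP μ lam X)
    (hlam : 0 < lam)
    {h : Plane → ℝ≥0∞} (hh : Measurable h) (h1 : ∀ x, h x ≤ 1) (hint : ∫⁻ x, h x ≠ ∞) :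
    ⨅ m : ℕ, ∫⁻ ω, ∏ i ∈ Finset.range m, (1 - h (X i ω)) ∂μ =
      ENNReal.ofReal (Real.exp (-(lam * (∫⁻ x, h x).toReal))) := by
  have hle : ∀ n x, SimpleFunc.eapprox h n x ≤ h x := fun n x => by
    rw [← SimpleFunc.iSup_eapprox_apply hh x]
    exact le_iSup (fun n => SimpleFunc.eapprox h n x) n
  have hanti : ∀ x, Antitone fun n => 1 - SimpleFunc.eapprox h n x := fun x m n hmn =>
    tsub_le_tsub_left (SimpleFunc.monotone_eapprox h hmn x) _
  have hintn : ∀ n, ∫⁻ x, SimpleFunc.eapprox h n x ≠ ∞ := fun n =>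
    ne_top_of_le_ne_top hint (lintegral_mono (hle n))
  have hlim : ∀ x, Filter.Tendsto (fun n => 1 - SimpleFunc.eapprox h n x) Filter.atTop
      (nhds (1 - h x)) := fun x =>
    ENNReal.Tendsto.sub tendsto_const_nhds (SimpleFunc.tendsto_eapprox hh x)
      (Or.inl ENNReal.one_ne_top)
  have hm : ∀ m : ℕ, ∫⁻ ω, ∏ i ∈ Finset.range m, (1 - h (X i ω)) ∂μ =
      ⨅ n : ℕ, ∫⁻ ω, ∏ i ∈ Finset.range m, (1 - SimpleFunc.eapprox h n (X i ω)) ∂μ := by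
    intro m
    have hanti2 : ∀ ω, Antitone fun n =>
        ∏ i ∈ Finset.range m, (1 - SimpleFunc.eapprox h n (X i ω)) := fun ω a b hab =>
      Finset.prod_le_prod' fun i _ => hanti _ hab
    rw [← lintegral_iInf (μ := μ)
      (f := fun n ω => ∏ i ∈ Finset.range m, (1 - SimpleFunc.eapprox h n (X i ω)))
      (fun n => Finset.measurable_prod _ fun i _ =>
        ((SimpleFunc.measurable _).comp (hX.measurable i)).const_sub 1)
      (fun a b hab ω => hanti2 ω hab)
      (ne_top_of_le_ne_top ENNReal.one_ne_top
        ((lintegral_mono fun ω => prod_one_sub_le_one _ _).trans (by simp)))]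
    refine lintegral_congr fun ω => ?_
    have ht : Filter.Tendsto
        (fun n => ∏ i ∈ Finset.range m, (1 - SimpleFunc.eapprox h n (X i ω))) Filter.atTop
        (nhds (∏ i ∈ Finset.range m, (1 - h (X i ω)))) :=
      ENNReal.tendsto_finsetProd_of_ne_top _ (fun i _ => hlim _)
        (fun i _ => ne_top_of_le_ne_top ENNReal.one_ne_top tsub_le_self)
    exact tendsto_nhds_unique ht (tendsto_atTop_iInf (hanti2 ω))
  simp_rw [hm]
  -- The products decrease both in the number of factors and in the approximation index, so both
  -- limits are infima and may be exchanged.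
  rw [iInf_comm]
  have hn : ∀ n : ℕ, _ := fun n => hX.iInf_lintegral_prod_simpleFunc hlam
    (SimpleFunc.eapprox h n) (fun x => (hle n x).trans (h1 x)) (hintn n)
  simp_rw [hn]
  have hlint : Filter.Tendsto (fun n => ∫⁻ x, SimpleFunc.eapprox h n x) Filter.atTop
      (nhds (∫⁻ x, h x)) :=
    lintegral_tendsto_of_tendsto_of_monotone (fun n => (SimpleFunc.measurable _).aemeasurable)
      (.of_forall fun x a b hab => SimpleFunc.monotone_eapprox h hab x)
      (.of_forall fun x => SimpleFunc.tendsto_eapprox hh x)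
  have ht : Filter.Tendsto (fun n => ENNReal.ofReal
      (Real.exp (-(lam * (∫⁻ x, SimpleFunc.eapprox h n x).toReal)))) Filter.atTop
      (nhds (ENNReal.ofReal (Real.exp (-(lam * (∫⁻ x, h x).toReal))))) := by
    refine ENNReal.tendsto_ofReal ((Real.continuous_exp.tendsto _).comp ?_)
    exact (((ENNReal.tendsto_toReal hint).comp hlint).const_mul lam).neg
  refine tendsto_nhds_unique (tendsto_atTop_iInf fun a b hab => ?_) ht
  refine ENNReal.ofReal_le_ofReal (Real.exp_le_exp.mpr (neg_le_neg ?_))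
  exact mul_le_mul_of_nonneg_left (ENNReal.toReal_mono (hintn b)
    (lintegral_mono (SimpleFunc.monotone_eapprox h hab))) hlam.le

end IsHomogeneousPPP

end PoissonProcess

/-! ### Averaging products over independent or conditionally independent factors. -/

/-- Integrating out an independent sequence `Y` that is independent of `A`, for a product of
functions each depending on a single `Y i`. -/
lemma lintegral_prod_of_iIndepFun_of_indepFun {Ω : Type*} [MeasurableSpace Ω]
    {μ : Measure Ω} [IsProbabilityMeasure μ] {β : Type*}
    [MeasurableSpace β] {Y : ℕ → Ω → ℝ} {A : Ω → β} (hY : ∀ i, Measurable (Y i))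
    (hA : Measurable A) (hi : iIndepFun Y μ) (hYA : IndepFun (fun ω i => Y i ω) A μ)
    (s : Finset ℕ) {F : ℕ → ℝ → β → ℝ≥0∞}
    (hF : ∀ i, Measurable (fun p : ℝ × β => F i p.1 p.2)) :
    ∫⁻ ω, ∏ i ∈ s, F i (Y i ω) (A ω) ∂μ =
      ∫⁻ ω, ∏ i ∈ s, (∫⁻ ω', F i (Y i ω') (A ω) ∂μ) ∂μ := by
  have hYm : Measurable fun ω i => Y i ω := measurable_pi_lambda _ hY
  have hG : Measurable fun p : (ℕ → ℝ) × β => ∏ i ∈ s, F i (p.1 i) p.2 :=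
    Finset.measurable_prod _ fun i _ => by
      have h : Measurable fun p : (ℕ → ℝ) × β => (p.1 i, p.2) := by fun_prop
      exact (hF i).comp h
  have : IsProbabilityMeasure (μ.map fun ω i => Y i ω) :=
    Measure.isProbabilityMeasure_map hYm.aemeasurable
  have : IsProbabilityMeasure (μ.map A) := Measure.isProbabilityMeasure_map hA.aemeasurable
  calc ∫⁻ ω, ∏ i ∈ s, F i (Y i ω) (A ω) ∂μ
      = ∫⁻ p, ∏ i ∈ s, F i (p.1 i) p.2 ∂(μ.map fun ω => ((fun i => Y i ω), A ω)) :=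
        (lintegral_map hG (hYm.prodMk hA)).symm
    _ = ∫⁻ a, ∫⁻ y, ∏ i ∈ s, F i (y i) a ∂(μ.map fun ω i => Y i ω) ∂(μ.map A) := by
        rw [(indepFun_iff_map_prod_eq_prod_map_map hYm.aemeasurable hA.aemeasurable).mp hYA,
          MeasureTheory.lintegral_prod_symm _ hG.aemeasurable]
    _ = ∫⁻ ω, ∫⁻ y, ∏ i ∈ s, F i (y i) (A ω) ∂(μ.map fun ω i => Y i ω) ∂μ :=
        lintegral_map hG.lintegral_prod_left' hA
    _ = _ := by
        refine lintegral_congr fun ω => ?_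
        have hFm : ∀ i, Measurable fun y => F i y (A ω) := fun i =>
          (hF i).comp (measurable_id.prodMk measurable_const)
        rw [lintegral_map (f := fun y : ℕ → ℝ => ∏ i ∈ s, F i (y i) (A ω))
          (Finset.measurable_prod _ fun i _ => (hFm i).comp (measurable_pi_apply i)) hYm]
        exact lintegral_prod_eq_prod_lintegral_of_indepFun s
          (fun i ω' => F i (Y i ω') (A ω)) (hi.comp (fun i y => F i y (A ω)) hFm)
          fun i => (hFm i).comp (hY i)

/-- Events that are conditionally independent given `m` may be replaced by their conditional
probabilities inside the expectation of a product. -/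
lemma integral_prod_indicator_mul_add {Ω : Type*} {m mΩ : MeasurableSpace Ω}
    {μ : Measure Ω} [IsProbabilityMeasure μ] (hm : m ≤ mΩ) {A : ℕ → Set Ω}
    (hA : ∀ i, MeasurableSet (A i)) {p : ℕ → Ω → ℝ}
    (hp : ∀ s : Finset ℕ, μ[(⋂ i ∈ s, A i).indicator (fun _ => (1 : ℝ)) | m]
      =ᵐ[μ] fun ω => ∏ i ∈ s, p i ω)
    {c b : ℕ → Ω → ℝ} (hc : ∀ i, Measurable[m] (c i)) (hb : ∀ i, Measurable[m] (b i))
    (hc1 : ∀ i ω, |c i ω| ≤ 1) (hb1 : ∀ i ω, |b i ω| ≤ 1) (s : Finset ℕ) :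
    ∫ ω, ∏ i ∈ s, ((A i).indicator (fun _ => (1 : ℝ)) ω * c i ω + b i ω) ∂μ =
      ∫ ω, ∏ i ∈ s, (p i ω * c i ω + b i ω) ∂μ := by
  classical
  -- Expanding the product, `t` collects the indices whose indicator term is chosen. The coefficient
  -- `g t` is bounded and `m`-measurable, so it can be pulled out of the conditional expectation.
  let g : Finset ℕ → Ω → ℝ := fun t ω => (∏ i ∈ t, c i ω) * ∏ i ∈ s \ t, b i ω
  have hgm : ∀ t, Measurable[m] (g t) := fun t =>
    (Finset.measurable_prod t fun i _ => hc i).mul (Finset.measurable_prod (s \ t) fun i _ => hb i)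
  have hg1 : ∀ t ω, ‖g t ω‖ ≤ 1 := by
    intro t ω
    simp only [g, norm_mul, norm_prod, Real.norm_eq_abs]
    exact mul_le_one₀ (Finset.prod_le_one (fun _ _ => abs_nonneg _) fun i _ => hc1 i ω)
      (Finset.prod_nonneg fun _ _ => abs_nonneg _)
      (Finset.prod_le_one (fun _ _ => abs_nonneg _) fun i _ => hb1 i ω)
  have hAs : ∀ t : Finset ℕ, MeasurableSet (⋂ i ∈ t, A i) := fun t =>
    Finset.measurableSet_biInter t fun i _ => hA i
  have hint1 : ∀ t : Finset ℕ, Integrable ((⋂ i ∈ t, A i).indicator fun _ => (1 : ℝ)) μ := fun t =>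
    (integrable_const 1).indicator (hAs t)
  have hint : ∀ t : Finset ℕ, Integrable (g t * (⋂ i ∈ t, A i).indicator fun _ => (1 : ℝ)) μ :=
    fun t => (hint1 t).bdd_mul ((hgm t).mono hm le_rfl).aestronglyMeasurable
      (.of_forall (hg1 t))
  have hce : ∀ t : Finset ℕ, μ[g t * (⋂ i ∈ t, A i).indicator (fun _ => (1 : ℝ)) | m] =ᵐ[μ]
      fun ω => g t ω * ∏ i ∈ t, p i ω := fun t => by
    filter_upwards [condExp_mul_of_stronglyMeasurable_left (hgm t).stronglyMeasurable (hint t)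
      (hint1 t), hp t] with ω h1 h2
    rw [h1, Pi.mul_apply, h2]
  have hL : ∀ ω, ∏ i ∈ s, ((A i).indicator (fun _ => (1 : ℝ)) ω * c i ω + b i ω) =
      ∑ t ∈ s.powerset, (g t * (⋂ i ∈ t, A i).indicator fun _ => (1 : ℝ)) ω := by
    intro ω
    rw [Finset.prod_add]
    refine Finset.sum_congr rfl fun t _ => ?_
    have : ∏ i ∈ t, (A i).indicator (fun _ => (1 : ℝ)) ω =
        (⋂ i ∈ t, A i).indicator (fun _ => (1 : ℝ)) ω := by
      by_cases h : ∀ i ∈ t, ω ∈ A i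
      · rw [Set.indicator_of_mem (by simpa using h)]
        exact Finset.prod_eq_one fun i hi => Set.indicator_of_mem (h i hi) _
      · rw [Set.indicator_of_notMem (by simpa using h)]
        push Not at h
        obtain ⟨i, hi, hiA⟩ := h
        exact Finset.prod_eq_zero hi (Set.indicator_of_notMem hiA _)
    rw [Finset.prod_mul_distrib, this, Pi.mul_apply]
    simp only [g]
    ring
  have hR : ∀ ω, ∏ i ∈ s, (p i ω * c i ω + b i ω) =
      ∑ t ∈ s.powerset, g t ω * ∏ i ∈ t, p i ω := by
    intro ω
    rw [Finset.prod_add]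
    refine Finset.sum_congr rfl fun t _ => ?_
    rw [Finset.prod_mul_distrib]
    simp only [g]
    ring
  simp_rw [hL, hR]
  rw [integral_finsetSum _ fun t _ => hint t,
    integral_finsetSum _ fun t _ => integrable_condExp.congr (hce t)]
  refine Finset.sum_congr rfl fun t _ => ?_
  rw [← integral_condExp hm, integral_congr_ae (hce t)]

/-! ### Exceedance probabilities of a single link. -/

lemma losProb_mem_Icc {c₁ c₂ : ℝ} (hc₂ : 0 < c₂) (θ : ℝ) : losProb c₁ c₂ θ ∈ Set.Icc (0 : ℝ) 1 := by
  have h := mul_pos hc₂ (Real.exp_pos (-c₁ * θ))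
  unfold losProb
  constructor
  · positivity
  · rw [div_le_one (by linarith)]; linarith

lemma measurable_losProb (c₁ c₂ : ℝ) : Measurable (losProb c₁ c₂) := by
  unfold losProb
  fun_prop

section ExceedProb
variable {Ω : Type*} [MeasurableSpace Ω]

/-- The probability that a link with weight `V`, attenuation `k` and length `d` has a gain
exceeding `r`. -/
noncomputable def exceedProb (μ : Measure Ω) (V : Ω → ℝ) (α r k d : ℝ) : ℝ :=
  μ.real {ω | r < V ω * k * d ^ (-α)}

/-- The probability that the gain of a link of length `d` exceeds `r`, if the link is line-of-sight
with probability `q`. -/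
noncomputable def linkExceedProb (μ : Measure Ω) (V : Ω → ℝ) (α ell r q d : ℝ) : ℝ :=
  q * exceedProb μ V α r 1 d + (1 - q) * exceedProb μ V α r ell d

/-- The probability that the gain of a point at ground distance `t` with random mark `M` exceeds
`r`, where `T` and `D` give the elevation angle and the distance of the point. -/
noncomputable def markedExceedProb (μ : Measure Ω) (V M : Ω → ℝ) (α c₁ c₂ ell r : ℝ)
    (T D : ℝ → ℝ → ℝ) (t : ℝ) : ℝ≥0∞ :=
  ∫⁻ ω, ENNReal.ofReal
    (linkExceedProb μ V α ell r (losProb c₁ c₂ (T t (M ω))) (D t (M ω))) ∂μ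

variable {μ : Measure Ω} [IsProbabilityMeasure μ] {V : Ω → ℝ} {α c₁ c₂ ell r : ℝ}

omit [IsProbabilityMeasure μ] in
lemma exceedProb_nonneg (k d : ℝ) : 0 ≤ exceedProb μ V α r k d := measureReal_nonneg

lemma exceedProb_le_one (k d : ℝ) : exceedProb μ V α r k d ≤ 1 := measureReal_le_one

lemma measurable_exceedProb (hV : Measurable V) (k : ℝ) : Measurable (exceedProb μ V α r k) := by
  have hs : MeasurableSet {p : ℝ × Ω | r < V p.2 * k * p.1 ^ (-α)} :=
    measurableSet_lt (by fun_prop) (by fun_prop)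
  exact (measurable_measure_prodMk_left hs (ν := μ)).ennreal_toReal

omit [IsProbabilityMeasure μ] in
lemma linkExceedProb_nonneg {q : ℝ} (hq : q ∈ Set.Icc (0 : ℝ) 1) (d : ℝ) :
    0 ≤ linkExceedProb μ V α ell r q d :=
  add_nonneg (mul_nonneg hq.1 (exceedProb_nonneg _ _))
    (mul_nonneg (by linarith [hq.2]) (exceedProb_nonneg _ _))

lemma linkExceedProb_le_one {q : ℝ} (hq : q ∈ Set.Icc (0 : ℝ) 1) (d : ℝ) :
    linkExceedProb μ V α ell r q d ≤ 1 := by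
  have h1 := mul_le_mul_of_nonneg_left
    (exceedProb_le_one (μ := μ) (V := V) (α := α) (r := r) 1 d) hq.1
  have h2 := mul_le_mul_of_nonneg_left
    (exceedProb_le_one (μ := μ) (V := V) (α := α) (r := r) ell d) (sub_nonneg.mpr hq.2)
  unfold linkExceedProb
  linarith

lemma measurable_linkExceedProb {β : Type*} [MeasurableSpace β] {q d : β → ℝ} (hV : Measurable V)
    (hq : Measurable q) (hd : Measurable d) :
    Measurable fun x => linkExceedProb μ V α ell r (q x) (d x) := by
  unfold linkExceedProb
  have h1 := (measurable_exceedProb (μ := μ) (α := α) (r := r) hV 1).comp hd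
  have h2 := (measurable_exceedProb (μ := μ) (α := α) (r := r) hV ell).comp hd
  exact (hq.mul h1).add ((hq.const_sub 1).mul h2)

variable {T D : ℝ → ℝ → ℝ} {M : Ω → ℝ}

lemma measurable_linkExceedProb_mark {β : Type*} [MeasurableSpace β] {t m : β → ℝ}
    (hV : Measurable V) (hT : Measurable fun p : ℝ × ℝ => T p.1 p.2)
    (hD : Measurable fun p : ℝ × ℝ => D p.1 p.2) (ht : Measurable t) (hm : Measurable m) :
    Measurable fun x =>
      linkExceedProb μ V α ell r (losProb c₁ c₂ (T (t x) (m x))) (D (t x) (m x)) :=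
  measurable_linkExceedProb hV ((measurable_losProb c₁ c₂).comp (hT.comp (ht.prodMk hm)))
    (hD.comp (ht.prodMk hm))

lemma measurable_markedExceedProb (hV : Measurable V) (hM : Measurable M)
    (hT : Measurable fun p : ℝ × ℝ => T p.1 p.2) (hD : Measurable fun p : ℝ × ℝ => D p.1 p.2) :
    Measurable (markedExceedProb μ V M α c₁ c₂ ell r T D) := by
  have h : Measurable fun p : ℝ × Ω => ENNReal.ofReal
      (linkExceedProb μ V α ell r (losProb c₁ c₂ (T p.1 (M p.2))) (D p.1 (M p.2))) :=
    (measurable_linkExceedProb_mark hV hT hD measurable_fst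
      (hM.comp measurable_snd)).ennreal_ofReal
  exact h.lintegral_prod_right'

lemma markedExceedProb_le_one (hc₂ : 0 < c₂) (t : ℝ) :
    markedExceedProb μ V M α c₁ c₂ ell r T D t ≤ 1 := by
  calc markedExceedProb μ V M α c₁ c₂ ell r T D t ≤ ∫⁻ _, 1 ∂μ :=
        lintegral_mono fun ω => ENNReal.ofReal_le_one.mpr
          (linkExceedProb_le_one (losProb_mem_Icc hc₂ _) _)
    _ = 1 := by simp

lemma lintegral_one_sub_linkExceedProb (hc₂ : 0 < c₂) (hV : Measurable V) (hM : Measurable M)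
    (hT : Measurable fun p : ℝ × ℝ => T p.1 p.2) (hD : Measurable fun p : ℝ × ℝ => D p.1 p.2)
    (t : ℝ) :
    ∫⁻ ω, ENNReal.ofReal
        (1 - linkExceedProb μ V α ell r (losProb c₁ c₂ (T t (M ω))) (D t (M ω))) ∂μ =
      1 - markedExceedProb μ V M α c₁ c₂ ell r T D t := by
  have hm : Measurable fun ω => ENNReal.ofReal
      (linkExceedProb μ V α ell r (losProb c₁ c₂ (T t (M ω))) (D t (M ω))) :=
    (measurable_linkExceedProb_mark hV hT hD measurable_const hM).ennreal_ofReal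
  simp_rw [ENNReal.ofReal_sub _ (linkExceedProb_nonneg (losProb_mem_Icc hc₂ _) _),
    ENNReal.ofReal_one]
  rw [lintegral_sub hm, lintegral_const, measure_univ, one_mul]
  · rfl
  · exact ne_top_of_le_ne_top ENNReal.one_ne_top (markedExceedProb_le_one hc₂ t)
  · exact .of_forall fun ω => ENNReal.ofReal_le_one.mpr
      (linkExceedProb_le_one (losProb_mem_Icc hc₂ _) _)

end ExceedProb

/-! ### Joint law of finitely many gains, by successive averaging. -/

namespace IsAerialModel

variable {Ω : Type*} [MeasurableSpace Ω] {μ : Measure Ω} [IsProbabilityMeasure μ]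
  {lam α c₁ c₂ ell r : ℝ} {X : ℕ → Ω → Plane} {H Θ : ℕ → Ω → ℝ} {los : ℕ → Set Ω} {W : ℕ → Ω → ℝ}

omit [IsProbabilityMeasure μ] in
lemma measurable_point3D (hm : IsAerialModel μ lam c₁ c₂ ell X H Θ los W) (i : ℕ) :
    Measurable (point3D X H i) := by
  have h1 := hm.ppp.measurable i
  have h2 := hm.measurable_altitude i
  unfold point3D
  fun_prop

omit [IsProbabilityMeasure μ] in
lemma measurable_losFactor (hm : IsAerialModel μ lam c₁ c₂ ell X H Θ los W) (i : ℕ) :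
    Measurable (losFactor ell los i) := by
  classical
  exact Measurable.ite (hm.measurable_los i) measurable_const measurable_const

omit [IsProbabilityMeasure μ] in
lemma measurable_gain (hm : IsAerialModel μ lam c₁ c₂ ell X H Θ los W) (i : ℕ) :
    Measurable (gain α ell X H los W i) :=
  ((hm.measurable_weight i).mul (hm.measurable_losFactor i)).mul
    ((hm.measurable_point3D i).norm.pow_const _)

omit [IsProbabilityMeasure μ] in
lemma sigmaU_le (hm : IsAerialModel μ lam c₁ c₂ ell X H Θ los W) :
    sigmaU X H ≤ ‹MeasurableSpace Ω› :=
  (measurable_pi_lambda _ hm.measurable_point3D).comap_le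

omit [IsProbabilityMeasure μ] [MeasurableSpace Ω] in
lemma measurable_sigmaU_point3D (i : ℕ) : Measurable[sigmaU X H] (point3D X H i) :=
  (measurable_pi_apply i).comp (comap_measurable fun ω i => point3D X H i ω)

/-- Integrating out the weights. -/
lemma measure_forall_gain_le_eq_lintegral_losFactor
    (hm : IsAerialModel μ lam c₁ c₂ ell X H Θ los W) (s : Finset ℕ) :
    μ {ω | ∀ i ∈ s, gain α ell X H los W i ω ≤ r} =
      ∫⁻ ω, ∏ i ∈ s, ENNReal.ofReal
        (1 - exceedProb μ (W 0) α r (losFactor ell los i ω) ‖point3D X H i ω‖) ∂μ := by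
  classical
  let F : ℕ → ℝ → (ℕ → ℝ × Space) → ℝ≥0∞ := fun i w a =>
    {w : ℝ | w * (a i).1 * ‖(a i).2‖ ^ (-α) ≤ r}.indicator 1 w
  have hF : ∀ i, Measurable fun p : ℝ × (ℕ → ℝ × Space) => F i p.1 p.2 := by
    intro i
    have hs : MeasurableSet {p : ℝ × (ℕ → ℝ × Space) |
        p.1 * (p.2 i).1 * ‖(p.2 i).2‖ ^ (-α) ≤ r} :=
      measurableSet_le (by fun_prop) (by fun_prop)
    exact measurable_one.indicator hs
  have hA : Measurable fun ω i => (losFactor ell los i ω, point3D X H i ω) :=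
    measurable_pi_lambda _ fun i => (hm.measurable_losFactor i).prodMk (hm.measurable_point3D i)
  have hms : MeasurableSet {ω | ∀ i ∈ s, gain α ell X H los W i ω ≤ r} := by
    have : {ω | ∀ i ∈ s, gain α ell X H los W i ω ≤ r} =
        ⋂ i ∈ s, {ω | gain α ell X H los W i ω ≤ r} := by ext; simp
    rw [this]
    exact Finset.measurableSet_biInter s fun i _ =>
      measurableSet_le (hm.measurable_gain i) measurable_const
  have key := lintegral_prod_of_iIndepFun_of_indepFun hm.measurable_weight hA hm.weight_iid.1
    hm.weight_indep s hF
  rw [← lintegral_indicator_one hms]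
  refine Eq.trans (lintegral_congr fun ω => ?_) (key.trans (lintegral_congr fun ω => ?_))
  · by_cases h : ∀ i ∈ s, gain α ell X H los W i ω ≤ r
    · simp only [Set.indicator_apply, Set.mem_ofPred_eq, F]
      rw [if_pos h]
      exact (Finset.prod_eq_one fun i hi => if_pos (h i hi)).symm
    · simp only [Set.indicator_apply, Set.mem_ofPred_eq, F]
      rw [if_neg h]
      push Not at h
      obtain ⟨i, hi, hr⟩ := h
      exact (Finset.prod_eq_zero hi (if_neg (not_le.mpr hr))).symm
  · refine Finset.prod_congr rfl fun i _ => ?_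
    set k := losFactor ell los i ω
    set d := ‖point3D X H i ω‖
    have hs : MeasurableSet {w : ℝ | w * k * d ^ (-α) ≤ r} :=
      measurableSet_le (by fun_prop) (by fun_prop)
    -- Identical distribution replaces every weight by `W 0`.
    have h1 : ∫⁻ ω', F i (W i ω') (fun i => (losFactor ell los i ω, point3D X H i ω)) ∂μ =
        ∫⁻ ω', {w : ℝ | w * k * d ^ (-α) ≤ r}.indicator 1 (W 0 ω') ∂μ :=
      ((hm.weight_iid.2 i).comp (measurable_one.indicator hs)).lintegral_eq
    have hs0 : MeasurableSet {ω' | r < W 0 ω' * k * d ^ (-α)} :=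
      measurableSet_lt measurable_const (((hm.measurable_weight 0).mul_const _).mul_const _)
    rw [h1, exceedProb, ← probReal_compl_eq_one_sub hs0, ofReal_measureReal,
      ← lintegral_indicator_one hs0.compl]
    refine lintegral_congr fun ω' => ?_
    simp only [Set.indicator_apply, Set.mem_ofPred_eq, Set.mem_compl_iff, not_lt, Pi.one_apply]

/-- Integrating out the weights and the line-of-sight events. -/
lemma measure_forall_gain_le_eq_lintegral_angle
    (hm : IsAerialModel μ lam c₁ c₂ ell X H Θ los W) (hc₂ : 0 < c₂) (s : Finset ℕ) :
    μ {ω | ∀ i ∈ s, gain α ell X H los W i ω ≤ r} =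
      ∫⁻ ω, ∏ i ∈ s, ENNReal.ofReal
        (1 - linkExceedProb μ (W 0) α ell r (losProb c₁ c₂ (Θ i ω)) ‖point3D X H i ω‖) ∂μ := by
  classical
  rw [hm.measure_forall_gain_le_eq_lintegral_losFactor s]
  let e : ℝ → ℕ → Ω → ℝ := fun k i ω => exceedProb μ (W 0) α r k ‖point3D X H i ω‖
  have he0 : ∀ k i ω, 0 ≤ e k i ω := fun k i ω => exceedProb_nonneg _ _
  have he1 : ∀ k i ω, e k i ω ≤ 1 := fun k i ω => exceedProb_le_one _ _
  have hem : ∀ k i, Measurable[sigmaU X H] (e k i) := fun k i =>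
    ((measurable_exceedProb (hm.measurable_weight 0) k).comp measurable_norm).comp
      (measurable_sigmaU_point3D i)
  have hem' : ∀ k i, Measurable (e k i) := fun k i => (hem k i).mono hm.sigmaU_le le_rfl
  -- The factor `1 - exceedProb` is affine in the line-of-sight indicator: it equals `1 - e 1` on
  -- `los i` and `1 - e ell` off it. The coefficients depend on the points alone.
  have key := integral_prod_indicator_mul_add hm.sigmaU_le hm.measurable_los hm.los_law
    (c := fun i ω => e ell i ω - e 1 i ω) (b := fun i ω => 1 - e ell i ω)
    (fun i => (hem ell i).sub (hem 1 i)) (fun i => (hem ell i).const_sub 1)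
    (fun i ω => abs_le.mpr ⟨by linarith [he0 ell i ω, he1 1 i ω], by
      linarith [he0 1 i ω, he1 ell i ω]⟩)
    (fun i ω => abs_le.mpr ⟨by linarith [he1 ell i ω], by linarith [he0 ell i ω]⟩) s
  have hL : ∀ i ω, (los i).indicator (fun _ => (1 : ℝ)) ω * (e ell i ω - e 1 i ω) +
      (1 - e ell i ω) = 1 - exceedProb μ (W 0) α r (losFactor ell los i ω) ‖point3D X H i ω‖ := by
    intro i ω
    by_cases h : ω ∈ los i
    · simp only [Set.indicator_of_mem h, losFactor, h, if_true, e]; ring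
    · simp only [Set.indicator_of_notMem h, losFactor, h, if_false, e]; ring
  have hR : ∀ i ω, losProb c₁ c₂ (Θ i ω) * (e ell i ω - e 1 i ω) + (1 - e ell i ω) =
      1 - linkExceedProb μ (W 0) α ell r (losProb c₁ c₂ (Θ i ω)) ‖point3D X H i ω‖ := by
    intro i ω
    simp only [linkExceedProb, e]; ring
  -- Conditional expectations are real-valued, so the lower integrals pass through Bochner integrals
  -- of products with factors in `[0, 1]`.
  have hbound : ∀ {f : ℕ → Ω → ℝ}, (∀ i, Measurable (f i)) → (∀ i ω, f i ω ∈ Set.Icc (0 : ℝ) 1) →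
      ∫⁻ ω, ∏ i ∈ s, ENNReal.ofReal (f i ω) ∂μ = ENNReal.ofReal (∫ ω, ∏ i ∈ s, f i ω ∂μ) := by
    intro f hf hf1
    rw [ofReal_integral_eq_lintegral_ofReal]
    · exact lintegral_congr fun ω =>
        (ENNReal.ofReal_prod_of_nonneg fun i _ => (hf1 i ω).1).symm
    · refine Integrable.of_bound (Finset.measurable_prod s fun i _ => hf i).aestronglyMeasurable 1
        (.of_forall fun ω => ?_)
      rw [Real.norm_eq_abs, abs_of_nonneg (Finset.prod_nonneg fun i _ => (hf1 i ω).1)]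
      exact Finset.prod_le_one (fun i _ => (hf1 i ω).1) fun i _ => (hf1 i ω).2
    · exact .of_forall fun ω => Finset.prod_nonneg fun i _ => (hf1 i ω).1
  rw [hbound, hbound]
  · simp_rw [← hL, ← hR]
    rw [key]
  · intro i
    exact (measurable_linkExceedProb (hm.measurable_weight 0)
      ((measurable_losProb c₁ c₂).comp (hm.measurable_angle i))
      (hm.measurable_point3D i).norm).const_sub 1
  · intro i ω
    constructor
    · linarith [linkExceedProb_le_one (μ := μ) (V := W 0) (α := α) (ell := ell) (r := r)
        (losProb_mem_Icc (c₁ := c₁) hc₂ (Θ i ω)) ‖point3D X H i ω‖]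
    · linarith [linkExceedProb_nonneg (μ := μ) (V := W 0) (α := α) (ell := ell) (r := r)
        (losProb_mem_Icc (c₁ := c₁) hc₂ (Θ i ω)) ‖point3D X H i ω‖]
  · intro i
    simp_rw [← hL]
    exact ((measurable_const.indicator (hm.measurable_los i)).mul
      ((hem' ell i).sub (hem' 1 i))).add ((hem' ell i).const_sub 1)
  · intro i ω
    have h0 := he0 (losFactor ell los i ω) i ω
    have h1 := he1 (losFactor ell los i ω) i ω
    exact ⟨by linarith, by linarith⟩

variable {M : ℕ → Ω → ℝ} {T D : ℝ → ℝ → ℝ}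

/-- Integrating out the weights, the line-of-sight events and independent marks `M` that determine
the angles and the distances. -/
lemma measure_forall_gain_le_eq_lintegral_norm
    (hm : IsAerialModel μ lam c₁ c₂ ell X H Θ los W) (hc₂ : 0 < c₂) (hM : ∀ i, Measurable (M i))
    (hiid : IsIID μ M) (hind : IndepFun (fun ω i => M i ω) (fun ω i => ‖X i ω‖) μ)
    (hT : Measurable fun p : ℝ × ℝ => T p.1 p.2) (hD : Measurable fun p : ℝ × ℝ => D p.1 p.2)
    (hΘ : ∀ i, ∀ᵐ ω ∂μ, Θ i ω = T ‖X i ω‖ (M i ω))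
    (hU : ∀ i, ∀ᵐ ω ∂μ, ‖point3D X H i ω‖ = D ‖X i ω‖ (M i ω)) (s : Finset ℕ) :
    μ {ω | ∀ i ∈ s, gain α ell X H los W i ω ≤ r} =
      ∫⁻ ω, ∏ i ∈ s, (1 - markedExceedProb μ (W 0) (M 0) α c₁ c₂ ell r T D ‖X i ω‖) ∂μ := by
  rw [hm.measure_forall_gain_le_eq_lintegral_angle hc₂ s]
  let G : ℝ → ℝ → ℝ≥0∞ := fun t m =>
    ENNReal.ofReal (1 - linkExceedProb μ (W 0) α ell r (losProb c₁ c₂ (T t m)) (D t m))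
  have hG : ∀ {β : Type} [MeasurableSpace β] {t m : β → ℝ}, Measurable t → Measurable m →
      Measurable fun x => G (t x) (m x) := fun ht hm' =>
    ((measurable_linkExceedProb_mark (hm.measurable_weight 0) hT hD ht hm').const_sub
      1).ennreal_ofReal
  have key := lintegral_prod_of_iIndepFun_of_indepFun (A := fun ω i => ‖X i ω‖) hM
    (measurable_pi_lambda _ fun i => (hm.ppp.measurable i).norm) hiid.1 hind s
    (F := fun i m a => G (a i) m) (fun i =>
      hG (t := fun p : ℝ × (ℕ → ℝ) => p.2 i) (by fun_prop) measurable_fst)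
  refine Eq.trans (lintegral_congr_ae ?_) (key.trans (lintegral_congr fun ω => ?_))
  · filter_upwards [ae_all_iff.mpr hΘ, ae_all_iff.mpr hU] with ω h1 h2
    exact Finset.prod_congr rfl fun i _ => by rw [h1 i, h2 i]
  · refine Finset.prod_congr rfl fun i _ => ?_
    have hGt : Measurable (G ‖X i ω‖) := hG measurable_const measurable_id
    rw [← lintegral_one_sub_linkExceedProb hc₂ (hm.measurable_weight 0) (hM 0) hT hD]
    exact ((hiid.2 i).comp hGt).lintegral_eq

end IsAerialModel

/-! ### Attainment of a supremum. -/

/-- If some term is positive, finitely many terms exceed a level `1 / (n + 1)` below it, and the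
largest of these is a global maximum. Otherwise all terms vanish. Countably many levels suffice,
which suits an almost sure hypothesis. -/
lemma isGreatest_iSup_of_finite {g : ℕ → ℝ} (h0 : ∀ i, 0 ≤ g i)
    (hfin : ∀ n : ℕ, {i | 1 / ((n : ℝ) + 1) < g i}.Finite) :
    IsGreatest (Set.range g) (⨆ i, g i) := by
  have hmax : ∃ i, ∀ j, g j ≤ g i := by
    by_cases h : ∃ i, 0 < g i
    · obtain ⟨i₀, hi₀⟩ := h
      obtain ⟨n, hn⟩ := exists_nat_one_div_lt hi₀
      obtain ⟨i, hi, hmax⟩ := (hfin n).exists_maximalFor g _ ⟨i₀, hn⟩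
      refine ⟨i, fun j => ?_⟩
      by_contra! hj
      exact absurd (hmax (j := j) (lt_trans hi hj) hj.le) (not_le.mpr hj)
    · push Not at h
      exact ⟨0, fun j => (h j).trans (h0 0)⟩
  obtain ⟨i, hi⟩ := hmax
  have hg : IsGreatest (Set.range g) (g i) := ⟨⟨i, rfl⟩, by rintro _ ⟨j, rfl⟩; exact hi j⟩
  have : ⨆ i, g i = g i := hg.csSup_eq
  rwa [this]

/-! ### Radial integrals over the plane in the variable `z = ‖x‖²`. -/

lemma volume_setOf_norm_sq_le (c : ℝ) :
    volume {x : Plane | ‖x‖ ^ 2 ≤ c} = ENNReal.ofReal Real.pi * ENNReal.ofReal c := by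
  rcases lt_or_ge c 0 with hc | hc
  · have : {x : Plane | ‖x‖ ^ 2 ≤ c} = ∅ := by
      ext x
      simp only [Set.mem_ofPred_eq, Set.mem_empty_iff_false, iff_false, not_le]
      exact hc.trans_le (sq_nonneg _)
    rw [this, measure_empty, ENNReal.ofReal_of_nonpos hc.le, mul_zero]
  · have : {x : Plane | ‖x‖ ^ 2 ≤ c} = Metric.closedBall 0 √c := by
      ext x
      simp only [Set.mem_ofPred_eq, mem_closedBall_zero_iff]
      exact (Real.le_sqrt (norm_nonneg x) hc).symm
    rw [this, EuclideanSpace.volume_closedBall_fin_two, ← ENNReal.ofReal_pow (Real.sqrt_nonneg c),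
      Real.sq_sqrt hc, mul_comm]

lemma map_norm_sq_volume :
    (volume : Measure Plane).map (fun x => ‖x‖ ^ 2) =
      ENNReal.ofReal Real.pi • volume.restrict (Set.Ioi (0 : ℝ)) := by
  have hm : Measurable fun x : Plane => ‖x‖ ^ 2 := by fun_prop
  have hL : ∀ c : ℝ, (volume : Measure Plane).map (fun x => ‖x‖ ^ 2) (Set.Iic c) =
      ENNReal.ofReal Real.pi * ENNReal.ofReal c := fun c => by
    rw [Measure.map_apply hm measurableSet_Iic]
    exact volume_setOf_norm_sq_le c
  have hR : ∀ c : ℝ, (ENNReal.ofReal Real.pi • volume.restrict (Set.Ioi (0 : ℝ))) (Set.Iic c) =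
      ENNReal.ofReal Real.pi * ENNReal.ofReal c := fun c => by
    rw [Measure.smul_apply, Measure.restrict_apply measurableSet_Iic, smul_eq_mul,
      Set.inter_comm, Set.Ioi_inter_Iic, Real.volume_Ioc, sub_zero]
  have htop : ∀ c : ℝ, ENNReal.ofReal Real.pi * ENNReal.ofReal c ≠ ∞ := fun c =>
    ENNReal.mul_ne_top ENNReal.ofReal_ne_top ENNReal.ofReal_ne_top
  -- Both measures give `π c⁺` to `Iic c`, which determines them on half-open intervals.
  refine Measure.ext_of_Ioc' _ _ (fun a b _ => ?_) fun a b hab => ?_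
  · exact ne_top_of_le_ne_top ((hL b).trans_ne (htop b)) (measure_mono Set.Ioc_subset_Iic_self)
  · rw [← Set.Iic_sdiff_Iic, measure_sdiff (Set.Iic_subset_Iic.mpr hab.le)
      measurableSet_Iic.nullMeasurableSet ((hL a).trans_ne (htop a)),
      measure_sdiff (Set.Iic_subset_Iic.mpr hab.le)
      measurableSet_Iic.nullMeasurableSet ((hR a).trans_ne (htop a)), hL, hL, hR, hR]

lemma lintegral_comp_norm_plane {h : ℝ → ℝ≥0∞} (hh : Measurable h) :
    ∫⁻ x : Plane, h ‖x‖ = ENNReal.ofReal Real.pi * ∫⁻ z in Set.Ioi (0 : ℝ), h √z := by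
  have hm : Measurable fun x : Plane => ‖x‖ ^ 2 := by fun_prop
  have hs : Measurable fun z : ℝ => h √z := hh.comp Real.continuous_sqrt.measurable
  rw [← smul_eq_mul, ← lintegral_smul_measure, ← map_norm_sq_volume, lintegral_map hs hm]
  simp_rw [Real.sqrt_sq (norm_nonneg _)]

/-! ### Exceedance as a condition on the squared ground distance. -/

section ExceedProb
variable {Ω : Type*} [MeasurableSpace Ω] {μ : Measure Ω} [IsProbabilityMeasure μ] {V : Ω → ℝ}
  {α r k : ℝ}

/-- Solving for `z` makes the exceedance set an interval starting at zero. Here `c` plays the role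
of the cosine of the elevation angle, and `c = 1` is a link along the ground. -/
lemma lt_mul_rpow_neg_iff (hα : 0 < α) (hr : 0 < r) {v c z : ℝ} (hv : 0 ≤ v) (hc : 0 < c)
    (hz : 0 < z) : r < v * (√z / c) ^ (-α) ↔ z < (v / r) ^ (2 / α) * c ^ 2 := by
  have hd : 0 < √z / c := div_pos (Real.sqrt_pos.mpr hz) hc
  have h1 : (√z / c) ^ α = (z / c ^ 2) ^ (α / 2) := by
    have : z / c ^ 2 = (√z / c) ^ (2 : ℝ) := by
      rw [Real.rpow_two, div_pow, Real.sq_sqrt hz.le]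
    rw [this, ← Real.rpow_mul hd.le]
    congr 1; ring
  have hp : 0 < (z / c ^ 2) ^ (α / 2) := Real.rpow_pos_of_pos (by positivity) _
  have h2 : (2 : ℝ) / α = (α / 2)⁻¹ := by rw [inv_div]
  rw [Real.rpow_neg hd.le, h1, ← div_eq_mul_inv, lt_div_iff₀ hp, mul_comm r, ← lt_div_iff₀ hr, h2,
    ← Real.lt_rpow_inv_iff_of_pos (by positivity) (by positivity) (by positivity),
    div_lt_iff₀ (by positivity)]

omit [IsProbabilityMeasure μ] in
lemma exceedProb_eq_ccdf (hk : 0 < k) {d : ℝ} (hd : 0 < d) :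
    exceedProb μ V α r k d = ccdf μ V (r / k * d ^ α) := by
  unfold exceedProb ccdf
  congr 1
  ext ω
  have hp : 0 < d ^ α := Real.rpow_pos_of_pos hd _
  simp only [Set.mem_ofPred_eq]
  rw [Real.rpow_neg hd.le, ← div_eq_mul_inv, lt_div_iff₀ hp, ← div_lt_iff₀ hk, div_mul_eq_mul_div]

-- This case realises the convention that the tail of `W` at infinity is zero when `ell = 0`.
omit [IsProbabilityMeasure μ] in
lemma exceedProb_zero_right (hr : 0 ≤ r) (d : ℝ) : exceedProb μ V α r 0 d = 0 := by
  unfold exceedProb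
  simp [not_lt.mpr hr]

/-- The smaller distance must be positive, because `0 ^ (-α) = 0` would break monotonicity. -/
lemma exceedProb_anti (hα : 0 < α) (hk : 0 ≤ k) (hV0 : ∀ᵐ ω ∂μ, 0 ≤ V ω) {d d' : ℝ} (hd : 0 < d)
    (hdd : d ≤ d') : exceedProb μ V α r k d' ≤ exceedProb μ V α r k d := by
  refine ENNReal.toReal_mono (measure_ne_top _ _) (measure_mono_ae ?_)
  filter_upwards [hV0] with ω hω h
  exact lt_of_lt_of_le h (mul_le_mul_of_nonneg_left
    (Real.rpow_le_rpow_of_nonpos hd hdd (by linarith)) (mul_nonneg hω hk))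

/-- By Tonelli the integral over `z` is taken first: for a fixed outcome it is the length of the
interval from `lt_mul_rpow_neg_iff`. The value `k = 0` is covered, since `0 ^ (2 / α) = 0`. -/
lemma lintegral_exceedProb_sqrt_div (hV : Measurable V) (hV0 : ∀ᵐ ω ∂μ, 0 ≤ V ω) (hα : 0 < α)
    (hr : 0 < r) (hk : 0 ≤ k) {c : ℝ} (hc : 0 < c) :
    ∫⁻ z in Set.Ioi (0 : ℝ), ENNReal.ofReal (exceedProb μ V α r k (√z / c)) =
      ENNReal.ofReal (c ^ 2 * k ^ (2 / α) * r ^ (-(2 / α))) *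
        ∫⁻ ω, ENNReal.ofReal (V ω ^ (2 / α)) ∂μ := by
  have hms : MeasurableSet {p : ℝ × Ω | r < V p.2 * k * (√p.1 / c) ^ (-α)} :=
    measurableSet_lt (by fun_prop) (by fun_prop)
  have h1 : ∀ z, ENNReal.ofReal (exceedProb μ V α r k (√z / c)) =
      ∫⁻ ω, {p : ℝ × Ω | r < V p.2 * k * (√p.1 / c) ^ (-α)}.indicator 1 (z, ω) ∂μ := fun z => by
    rw [exceedProb, ofReal_measureReal]
    have hz : MeasurableSet {ω | r < V ω * k * (√z / c) ^ (-α)} :=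
      measurableSet_lt (by fun_prop) (by fun_prop)
    rw [← lintegral_indicator_one hz]
    rfl
  simp_rw [h1]
  rw [lintegral_lintegral_swap (f := fun z ω =>
      {p : ℝ × Ω | r < V p.2 * k * (√p.1 / c) ^ (-α)}.indicator (1 : ℝ × Ω → ℝ≥0∞) (z, ω)) (measurable_one.indicator hms).aemeasurable,
    ← lintegral_const_mul _ (hV.pow_const _).ennreal_ofReal]
  refine lintegral_congr_ae ?_
  filter_upwards [hV0] with ω hω
  have hr0 : 0 ≤ (V ω * k / r) ^ (2 / α) * c ^ 2 := by positivity
  have h2 : ∫⁻ z in Set.Ioi (0 : ℝ),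
      {p : ℝ × Ω | r < V p.2 * k * (√p.1 / c) ^ (-α)}.indicator (1 : ℝ × Ω → ℝ≥0∞) (z, ω) =
      ∫⁻ z in Set.Ioi (0 : ℝ), (Set.Iio ((V ω * k / r) ^ (2 / α) * c ^ 2)).indicator 1 z := by
    refine setLIntegral_congr_fun measurableSet_Ioi fun z hz => ?_
    simp only [Set.indicator_apply, Set.mem_ofPred_eq, Set.mem_Iio, Pi.one_apply]
    simp only [lt_mul_rpow_neg_iff hα hr (mul_nonneg hω hk) hc hz]
  rw [h2, lintegral_indicator_one measurableSet_Iio, Measure.restrict_apply measurableSet_Iio,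
    Set.Iio_inter_Ioi, Real.volume_Ioo, sub_zero, ← ENNReal.ofReal_mul (by positivity)]
  congr 1
  rw [Real.div_rpow (mul_nonneg hω hk) hr.le, Real.mul_rpow hω hk, Real.rpow_neg hr.le]
  ring

end ExceedProb

/-! ### Attainment and distribution of the maximum for general marks. -/

namespace IsAerialModel

variable {Ω : Type*} [MeasurableSpace Ω] {μ : Measure Ω} [IsProbabilityMeasure μ]
  {lam α c₁ c₂ ell r : ℝ} {X : ℕ → Ω → Plane} {H Θ : ℕ → Ω → ℝ} {los : ℕ → Set Ω} {W : ℕ → Ω → ℝ}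
  {M : ℕ → Ω → ℝ} {T D : ℝ → ℝ → ℝ}

omit [IsProbabilityMeasure μ] in
lemma ae_gain_nonneg (hm : IsAerialModel μ lam c₁ c₂ ell X H Θ los W) (hell : 0 ≤ ell) :
    ∀ᵐ ω ∂μ, ∀ i, 0 ≤ gain α ell X H los W i ω := by
  filter_upwards [ae_all_iff.mpr hm.weight_nonneg] with ω hω i
  refine mul_nonneg (mul_nonneg (hω i) ?_) (Real.rpow_nonneg (norm_nonneg _) _)
  unfold losFactor
  split_ifs
  exacts [zero_le_one, hell]

/-- Both scenarios at once: if i.i.d. marks independent of the ground distances determine the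
angles and the distances, then the maximal gain is attained and has a void-probability law. -/
lemma isGreatest_and_cdf_of_marks
    (hm : IsAerialModel μ lam c₁ c₂ ell X H Θ los W) (hlam : 0 < lam) (hell : 0 ≤ ell)
    (hc₂ : 0 < c₂) (hM : ∀ i, Measurable (M i))
    (hiid : IsIID μ M) (hind : IndepFun (fun ω i => M i ω) (fun ω i => ‖X i ω‖) μ)
    (hT : Measurable fun p : ℝ × ℝ => T p.1 p.2) (hD : Measurable fun p : ℝ × ℝ => D p.1 p.2)
    (hΘ : ∀ i, ∀ᵐ ω ∂μ, Θ i ω = T ‖X i ω‖ (M i ω))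
    (hU : ∀ i, ∀ᵐ ω ∂μ, ‖point3D X H i ω‖ = D ‖X i ω‖ (M i ω))
    (hfin : ∀ r, 0 < r → ∫⁻ z in Set.Ioi (0 : ℝ),
      markedExceedProb μ (W 0) (M 0) α c₁ c₂ ell r T D √z ≠ ∞) :
    (∀ᵐ ω ∂μ, IsGreatest (Set.range fun i => gain α ell X H los W i ω)
        (Rstar α ell X H los W ω)) ∧
      ∀ r : ℝ, 0 < r → cdf (μ.map (Rstar α ell X H los W)) r =
        Real.exp (-(Real.pi * lam * (∫⁻ z in Set.Ioi (0 : ℝ),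
          markedExceedProb μ (W 0) (M 0) α c₁ c₂ ell r T D √z).toReal)) := by
  have hhm : ∀ r, Measurable (markedExceedProb μ (W 0) (M 0) α c₁ c₂ ell r T D) := fun r =>
    measurable_markedExceedProb (hm.measurable_weight 0) (hM 0) hT hD
  have hhn : ∀ r, Measurable fun x : Plane =>
      markedExceedProb μ (W 0) (M 0) α c₁ c₂ ell r T D ‖x‖ := fun r => (hhm r).comp measurable_norm
  have hint : ∀ r, 0 < r →
      ∫⁻ x : Plane, markedExceedProb μ (W 0) (M 0) α c₁ c₂ ell r T D ‖x‖ ≠ ∞ := fun r hr => by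
    rw [lintegral_comp_norm_plane (hhm r)]
    exact ENNReal.mul_ne_top ENNReal.ofReal_ne_top (hfin r hr)
  have hfinite : ∀ r, 0 < r → ∀ᵐ ω ∂μ, {i | r < gain α ell X H los W i ω}.Finite := by
    intro r hr
    have h1 : ∀ i, μ {ω | r < gain α ell X H los W i ω} =
        ∫⁻ ω, markedExceedProb μ (W 0) (M 0) α c₁ c₂ ell r T D ‖X i ω‖ ∂μ := by
      intro i
      have hms : MeasurableSet {ω | gain α ell X H los W i ω ≤ r} :=
        measurableSet_le (hm.measurable_gain i) measurable_const
      have hle : ∫⁻ ω, markedExceedProb μ (W 0) (M 0) α c₁ c₂ ell r T D ‖X i ω‖ ∂μ ≤ 1 :=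
        (lintegral_mono fun ω => markedExceedProb_le_one hc₂ _).trans (by simp)
      -- The joint formula on a singleton gives the exceedance probability of one gain.
      have h := hm.measure_forall_gain_le_eq_lintegral_norm (r := r) (α := α) hc₂ hM hiid hind
        hT hD hΘ hU {i}
      simp only [Finset.mem_singleton, forall_eq, Finset.prod_singleton] at h
      rw [lintegral_sub
        (g := fun ω => markedExceedProb μ (W 0) (M 0) α c₁ c₂ ell r T D ‖X i ω‖) ((hhn r).comp (hm.ppp.measurable i))
        (ne_top_of_le_ne_top ENNReal.one_ne_top hle)
        (.of_forall fun ω => markedExceedProb_le_one hc₂ _), lintegral_const, measure_univ,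
        one_mul] at h
      have hc : {ω | r < gain α ell X H los W i ω} = {ω | gain α ell X H los W i ω ≤ r}ᶜ := by
        ext ω; simp
      rw [hc, prob_compl_eq_one_sub hms, h, ENNReal.sub_sub_cancel ENNReal.one_ne_top hle]
    -- Borel–Cantelli: by Campbell's theorem the exceedance probabilities sum to `lam` times a
    -- finite integral.
    refine ae_finite_setOfPred_mem (s := fun i => {ω | r < gain α ell X H los W i ω}) ?_
    simp_rw [h1]
    rw [hm.ppp.tsum_lintegral (hhn r)]
    exact ENNReal.mul_ne_top ENNReal.ofReal_ne_top (hint r hr)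
  have hmax : ∀ᵐ ω ∂μ, IsGreatest (Set.range fun i => gain α ell X H los W i ω)
      (Rstar α ell X H los W ω) := by
    filter_upwards [hm.ae_gain_nonneg (α := α) hell,
      ae_all_iff.mpr fun n : ℕ => hfinite (1 / ((n : ℝ) + 1)) (by positivity)] with ω h0 h1
    exact isGreatest_iSup_of_finite h0 h1
  refine ⟨hmax, fun r hr => ?_⟩
  have hRm : Measurable (Rstar α ell X H los W) := Measurable.iSup fun i => hm.measurable_gain i
  have : IsProbabilityMeasure (μ.map (Rstar α ell X H los W)) :=
    Measure.isProbabilityMeasure_map hRm.aemeasurable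
  rw [cdf_eq_real, measureReal_def, Measure.map_apply hRm measurableSet_Iic]
  -- Attainment matters here: the real supremum of an unbounded family is `0` by default, and would
  -- then not bound the gains.
  have hset : μ (Rstar α ell X H los W ⁻¹' Set.Iic r) =
      μ (⋂ m : ℕ, {ω | ∀ i ∈ Finset.range m, gain α ell X H los W i ω ≤ r}) := by
    refine measure_congr ?_
    filter_upwards [hmax] with ω hω
    refine propext ?_
    change Rstar α ell X H los W ω ≤ r ↔
      ω ∈ ⋂ m : ℕ, {ω | ∀ i ∈ Finset.range m, gain α ell X H los W i ω ≤ r}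
    simp only [Set.mem_iInter, Set.mem_ofPred_eq]
    refine ⟨fun h m i _ => (hω.2 ⟨i, rfl⟩).trans h, fun h => ?_⟩
    obtain ⟨i, hi⟩ := hω.1
    rw [← hi]
    exact h (i + 1) i (Finset.self_mem_range_succ i)
  have hms : ∀ m : ℕ, MeasurableSet
      {ω | ∀ i ∈ Finset.range m, gain α ell X H los W i ω ≤ r} := fun m => by
    have : {ω | ∀ i ∈ Finset.range m, gain α ell X H los W i ω ≤ r} =
        ⋂ i ∈ Finset.range m, {ω | gain α ell X H los W i ω ≤ r} := by ext; simp
    rw [this]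
    exact Finset.measurableSet_biInter _ fun i _ =>
      measurableSet_le (hm.measurable_gain i) measurable_const
  have hanti : Antitone fun m : ℕ =>
      {ω | ∀ i ∈ Finset.range m, gain α ell X H los W i ω ≤ r} := fun m n hmn ω h i hi =>
    h i (Finset.range_mono hmn hi)
  rw [hset, hanti.measure_iInter (fun m => (hms m).nullMeasurableSet) ⟨0, measure_ne_top _ _⟩]
  simp_rw [hm.measure_forall_gain_le_eq_lintegral_norm hc₂ hM hiid hind hT hD hΘ hU]
  rw [hm.ppp.iInf_lintegral_prod hlam (hhn r) (fun x => markedExceedProb_le_one hc₂ _) (hint r hr),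
    ENNReal.toReal_ofReal (Real.exp_pos _).le, lintegral_comp_norm_plane (hhm r),
    ENNReal.toReal_mul, ENNReal.toReal_ofReal Real.pi_pos.le]
  congr 1
  ring

end IsAerialModel

/-! ### The exponent in each scenario. -/

section ScenarioIntegrals
variable {Ω : Type*} [MeasurableSpace Ω] {μ : Measure Ω} [IsProbabilityMeasure μ] {V : Ω → ℝ}
  {α c₁ c₂ ell r : ℝ}

lemma lintegral_ofReal_linkExceedProb_sqrt_div (hV : Measurable V) (hV0 : ∀ᵐ ω ∂μ, 0 ≤ V ω)
    (hVint : Integrable (fun ω => V ω ^ (2 / α)) μ) (hα : 0 < α) (hr : 0 < r) (hell : 0 ≤ ell)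
    {q : ℝ} (hq : q ∈ Set.Icc (0 : ℝ) 1) {c : ℝ} (hc : 0 < c) :
    ∫⁻ z in Set.Ioi (0 : ℝ), ENNReal.ofReal (linkExceedProb μ V α ell r q (√z / c)) =
      ENNReal.ofReal (c ^ 2 * (q * (1 - ell ^ (2 / α)) + ell ^ (2 / α)) *
        (r ^ (-(2 / α)) * ∫ ω, V ω ^ (2 / α) ∂μ)) := by
  have hq1 : 0 ≤ 1 - q := sub_nonneg.mpr hq.2
  have hm : ∀ k, Measurable fun z : ℝ => ENNReal.ofReal (exceedProb μ V α r k (√z / c)) := fun k =>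
    ((measurable_exceedProb hV k).comp
      (Real.continuous_sqrt.measurable.div_const c)).ennreal_ofReal
  have hV0' : 0 ≤ᵐ[μ] fun ω => V ω ^ (2 / α) := by
    filter_upwards [hV0] with ω hω using Real.rpow_nonneg hω _
  have hE : 0 ≤ ∫ ω, V ω ^ (2 / α) ∂μ := integral_nonneg_of_ae hV0'
  have h1 : ∀ z : ℝ, ENNReal.ofReal (linkExceedProb μ V α ell r q (√z / c)) =
      ENNReal.ofReal q * ENNReal.ofReal (exceedProb μ V α r 1 (√z / c)) +
      ENNReal.ofReal (1 - q) * ENNReal.ofReal (exceedProb μ V α r ell (√z / c)) := fun z => by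
    rw [linkExceedProb, ENNReal.ofReal_add (mul_nonneg hq.1 (exceedProb_nonneg _ _))
      (mul_nonneg hq1 (exceedProb_nonneg _ _)), ENNReal.ofReal_mul hq.1, ENNReal.ofReal_mul hq1]
  have hp : ∀ k : ℝ, 0 ≤ k → 0 ≤ c ^ 2 * k ^ (2 / α) * r ^ (-(2 / α)) := fun k hk => by positivity
  simp_rw [h1]
  rw [lintegral_add_left ((hm 1).const_mul _), lintegral_const_mul _ (hm 1),
    lintegral_const_mul _ (hm ell), lintegral_exceedProb_sqrt_div hV hV0 hα hr zero_le_one hc,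
    lintegral_exceedProb_sqrt_div hV hV0 hα hr hell hc,
    ← ofReal_integral_eq_lintegral_ofReal hVint hV0',
    ← ENNReal.ofReal_mul (hp 1 zero_le_one), ← ENNReal.ofReal_mul (hp ell hell),
    ← ENNReal.ofReal_mul hq.1, ← ENNReal.ofReal_mul hq1,
    ← ENNReal.ofReal_add (mul_nonneg hq.1 (mul_nonneg (hp 1 zero_le_one) hE))
      (mul_nonneg hq1 (mul_nonneg (hp ell hell) hE)), Real.one_rpow]
  congr 1
  ring

/-- Integrating over `z` before averaging over the angle leaves a closed form in which the angle
enters only through `cos²` and the line-of-sight probability. -/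
lemma lintegral_markedExceedProb_div_cos (hV : Measurable V) (hV0 : ∀ᵐ ω ∂μ, 0 ≤ V ω)
    (hVint : Integrable (fun ω => V ω ^ (2 / α)) μ) (hα : 0 < α) (hr : 0 < r)
    (hell : ell ∈ Set.Icc (0 : ℝ) 1) (hc₂ : 0 < c₂) {A : Ω → ℝ} (hA : Measurable A)
    (hcos : ∀ᵐ ω ∂μ, 0 < Real.cos (A ω)) :
    ∫⁻ z in Set.Ioi (0 : ℝ), markedExceedProb μ V A α c₁ c₂ ell r (fun _ θ => θ)
        (fun t θ => t / Real.cos θ) √z =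
      ENNReal.ofReal ((∫ ω, V ω ^ (2 / α) ∂μ) * omegaConst μ α c₁ c₂ ell A *
        r ^ (-(2 / α))) := by
  have hpow : ell ^ (2 / α) ≤ 1 := Real.rpow_le_one hell.1 hell.2 (by positivity)
  have hpow0 : 0 ≤ ell ^ (2 / α) := Real.rpow_nonneg hell.1 _
  have hmeas : Measurable fun p : ℝ × Ω => ENNReal.ofReal
      (linkExceedProb μ V α ell r (losProb c₁ c₂ (A p.2)) (√p.1 / Real.cos (A p.2))) :=
    (measurable_linkExceedProb hV ((measurable_losProb c₁ c₂).comp (hA.comp measurable_snd))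
      (by fun_prop)).ennreal_ofReal
  unfold markedExceedProb
  rw [lintegral_lintegral_swap (f := fun z ω => ENNReal.ofReal
    (linkExceedProb μ V α ell r (losProb c₁ c₂ (A ω)) (√z / Real.cos (A ω))))
    hmeas.aemeasurable]
  have h1 : ∀ᵐ ω ∂μ, ∫⁻ z in Set.Ioi (0 : ℝ), ENNReal.ofReal
      (linkExceedProb μ V α ell r (losProb c₁ c₂ (A ω)) (√z / Real.cos (A ω))) =
      ENNReal.ofReal (Real.cos (A ω) ^ 2 *
        (losProb c₁ c₂ (A ω) * (1 - ell ^ (2 / α)) + ell ^ (2 / α)) *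
        (r ^ (-(2 / α)) * ∫ ω, V ω ^ (2 / α) ∂μ)) := by
    filter_upwards [hcos] with ω hω
    exact lintegral_ofReal_linkExceedProb_sqrt_div hV hV0 hVint hα hr hell.1
      (losProb_mem_Icc hc₂ _) hω
  have hE : 0 ≤ ∫ ω, V ω ^ (2 / α) ∂μ := integral_nonneg_of_ae (by
    filter_upwards [hV0] with ω hω using Real.rpow_nonneg hω _)
  have hf0 : ∀ ω, 0 ≤ Real.cos (A ω) ^ 2 *
      (losProb c₁ c₂ (A ω) * (1 - ell ^ (2 / α)) + ell ^ (2 / α)) := fun ω =>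
    mul_nonneg (sq_nonneg _) (add_nonneg
      (mul_nonneg (losProb_mem_Icc hc₂ _).1 (sub_nonneg.mpr hpow)) hpow0)
  have hfm : Measurable fun ω => Real.cos (A ω) ^ 2 *
      (losProb c₁ c₂ (A ω) * (1 - ell ^ (2 / α)) + ell ^ (2 / α)) :=
    (hA.cos.pow_const 2).mul
      ((((measurable_losProb c₁ c₂).comp hA).mul_const _).add_const _)
  have hfint : Integrable (fun ω => Real.cos (A ω) ^ 2 *
      (losProb c₁ c₂ (A ω) * (1 - ell ^ (2 / α)) + ell ^ (2 / α))) μ := by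
    refine Integrable.of_bound hfm.aestronglyMeasurable 1 (.of_forall fun ω => ?_)
    rw [Real.norm_eq_abs, abs_of_nonneg (hf0 ω)]
    have hρ := losProb_mem_Icc (c₁ := c₁) hc₂ (A ω)
    refine mul_le_one₀ (Real.cos_sq_le_one _) ?_ ?_
    · exact add_nonneg (mul_nonneg hρ.1 (sub_nonneg.mpr hpow)) hpow0
    · have := mul_le_mul_of_nonneg_right hρ.2 (sub_nonneg.mpr hpow)
      linarith
  rw [lintegral_congr_ae h1, ← ofReal_integral_eq_lintegral_ofReal (hfint.mul_const _)
    (.of_forall fun ω => mul_nonneg (hf0 ω) (mul_nonneg (Real.rpow_nonneg hr.le _) hE)),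
    integral_mul_const, omegaConst]
  congr 1
  ring

lemma markedExceedProb_arctan_eq (hV : Measurable V) {h : Ω → ℝ} (hh : Measurable h)
    (hr : 0 < r) (hell : 0 ≤ ell) (hc₂ : 0 < c₂) {z : ℝ} (hz : 0 < z) :
    markedExceedProb μ V h α c₁ c₂ ell r (fun t x => Real.arctan (x / t))
        (fun t x => √(t ^ 2 + x ^ 2)) √z =
      ENNReal.ofReal (OmegaIntegrand μ α c₁ c₂ ell V h r z) := by
  have hterm : ∀ ω, linkExceedProb μ V α ell r (losProb c₁ c₂ (Real.arctan (h ω / √z)))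
      (√(√z ^ 2 + h ω ^ 2)) =
      losProb c₁ c₂ (Real.arctan (h ω / √z)) * ccdf μ V (r * (z + h ω ^ 2) ^ (α / 2)) +
      (1 - losProb c₁ c₂ (Real.arctan (h ω / √z))) *
        (if ell = 0 then 0 else ccdf μ V (r / ell * (z + h ω ^ 2) ^ (α / 2))) := by
    intro ω
    have hp : 0 < z + h ω ^ 2 := by positivity
    have hs : √(z + h ω ^ 2) ^ α = (z + h ω ^ 2) ^ (α / 2) := by
      rw [Real.sqrt_eq_rpow, ← Real.rpow_mul hp.le]
      congr 1; ring
    rw [linkExceedProb, Real.sq_sqrt hz.le,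
      exceedProb_eq_ccdf one_pos (Real.sqrt_pos.mpr hp), hs, div_one]
    congr 2
    split_ifs with h0
    · rw [h0, exceedProb_zero_right hr.le]
    · rw [exceedProb_eq_ccdf (lt_of_le_of_ne hell (Ne.symm h0)) (Real.sqrt_pos.mpr hp), hs]
  unfold markedExceedProb OmegaIntegrand
  simp_rw [← hterm]
  rw [ofReal_integral_eq_lintegral_ofReal]
  · refine Integrable.of_bound (measurable_linkExceedProb hV
      ((measurable_losProb c₁ c₂).comp (by fun_prop)) (by fun_prop)).aestronglyMeasurable 1
      (.of_forall fun ω => ?_)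
    rw [Real.norm_eq_abs, abs_of_nonneg (linkExceedProb_nonneg (losProb_mem_Icc hc₂ _) _)]
    exact linkExceedProb_le_one (losProb_mem_Icc hc₂ _) _
  · exact .of_forall fun ω => linkExceedProb_nonneg (losProb_mem_Icc hc₂ _) _

omit [IsProbabilityMeasure μ] in
lemma OmegaIntegrand_nonneg (hc₂ : 0 < c₂) (h : Ω → ℝ) (z : ℝ) :
    0 ≤ OmegaIntegrand μ α c₁ c₂ ell V h r z := by
  refine integral_nonneg fun ω => ?_
  have hρ := losProb_mem_Icc (c₁ := c₁) hc₂ (Real.arctan (h ω / √z))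
  refine add_nonneg (mul_nonneg hρ.1 measureReal_nonneg)
    (mul_nonneg (sub_nonneg.mpr hρ.2) ?_)
  split_ifs
  exacts [le_rfl, measureReal_nonneg]

/-- A link is at least as long as its ground projection, and exceedance decreases with length. Hence
the ground-level exceedance probabilities for attenuations `1` and `ell` dominate, and each has
integral governed by the moment of order `2 / α`. -/
lemma lintegral_markedExceedProb_ne_top (hV : Measurable V) (hV0 : ∀ᵐ ω ∂μ, 0 ≤ V ω)
    (hVint : Integrable (fun ω => V ω ^ (2 / α)) μ) (hα : 0 < α) (hr : 0 < r)
    (hell : 0 ≤ ell) (hc₂ : 0 < c₂) {M : Ω → ℝ} {T D : ℝ → ℝ → ℝ}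
    (hD : ∀ t m, t ≤ D t m) :
    ∫⁻ z in Set.Ioi (0 : ℝ), markedExceedProb μ V M α c₁ c₂ ell r T D √z ≠ ∞ := by
  have hbound : ∀ k, 0 ≤ k → ∫⁻ z in Set.Ioi (0 : ℝ),
      ENNReal.ofReal (exceedProb μ V α r k √z) ≠ ∞ := fun k hk => by
    have h := lintegral_exceedProb_sqrt_div (k := k) hV hV0 hα hr hk one_pos
    simp only [div_one] at h
    rw [h, ← ofReal_integral_eq_lintegral_ofReal hVint (by
      filter_upwards [hV0] with ω hω using Real.rpow_nonneg hω _)]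
    exact ENNReal.mul_ne_top ENNReal.ofReal_ne_top ENNReal.ofReal_ne_top
  have hm : Measurable fun z : ℝ => ENNReal.ofReal (exceedProb μ V α r 1 √z) :=
    ((measurable_exceedProb hV 1).comp Real.continuous_sqrt.measurable).ennreal_ofReal
  refine ne_top_of_le_ne_top (ENNReal.add_ne_top.mpr
    ⟨hbound 1 zero_le_one, hbound ell hell⟩) ?_
  rw [← lintegral_add_left hm]
  refine setLIntegral_mono' measurableSet_Ioi fun z hz => ?_
  have hz' : 0 < √z := Real.sqrt_pos.mpr hz
  calc markedExceedProb μ V M α c₁ c₂ ell r T D √z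
      ≤ ∫⁻ _, (ENNReal.ofReal (exceedProb μ V α r 1 √z) +
          ENNReal.ofReal (exceedProb μ V α r ell √z)) ∂μ := by
        refine lintegral_mono fun ω => ?_
        rw [← ENNReal.ofReal_add (exceedProb_nonneg _ _) (exceedProb_nonneg _ _)]
        refine ENNReal.ofReal_le_ofReal ?_
        have hρ := losProb_mem_Icc (c₁ := c₁) hc₂ (T √z (M ω))
        have h1 := exceedProb_anti (r := r) hα zero_le_one hV0 hz' (hD √z (M ω))
        have h2 := exceedProb_anti (r := r) hα hell hV0 hz' (hD √z (M ω))
        have h3 := mul_le_mul hρ.2 h1 (exceedProb_nonneg _ _) zero_le_one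
        have h4 := mul_le_mul (sub_le_self 1 hρ.1) h2 (exceedProb_nonneg _ _) zero_le_one
        unfold linkExceedProb
        linarith
    _ = _ := by simp

end ScenarioIntegrals

/-! ### Geometry of the links, and the two scenarios. -/

namespace IsAerialModel

variable {Ω : Type*} [MeasurableSpace Ω] {μ : Measure Ω} {lam c₁ c₂ ell : ℝ}
  {X : ℕ → Ω → Plane} {H Θ : ℕ → Ω → ℝ} {los : ℕ → Set Ω} {W : ℕ → Ω → ℝ}

omit [MeasurableSpace Ω] in
lemma norm_point3D (i : ℕ) (ω : Ω) : ‖point3D X H i ω‖ = √(‖X i ω‖ ^ 2 + H i ω ^ 2) := by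
  rw [← Real.sqrt_sq (norm_nonneg (point3D X H i ω)), WithLp.prod_norm_sq_eq_of_L2]
  simp [point3D]

/-- A vanishing cosine would force `‖X i‖ sin Θ = 0`, hence `sin Θ = 0` as `X i ≠ 0` almost surely,
contradicting `sin² + cos² = 1`. -/
lemma ae_cos_angle_pos (hm : IsAerialModel μ lam c₁ c₂ ell X H Θ los W) (i : ℕ) :
    ∀ᵐ ω ∂μ, 0 < Real.cos (Θ i ω) := by
  filter_upwards [hm.angle_mem i, hm.altitude_eq i, hm.ppp.ae_ne_zero i] with ω h1 h2 h3
  refine lt_of_le_of_ne (Real.cos_nonneg_of_mem_Icc ⟨by linarith [h1.1, Real.pi_pos], h1.2⟩)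
    fun h0 => ?_
  have hs : Real.sin (Θ i ω) = 0 := by
    rw [← h0, mul_zero, eq_comm, mul_eq_zero] at h2
    exact h2.resolve_left (norm_ne_zero_iff.mpr h3)
  have := Real.sin_sq_add_cos_sq (Θ i ω)
  rw [hs, ← h0] at this
  norm_num at this

lemma ae_norm_point3D_eq_div_cos (hm : IsAerialModel μ lam c₁ c₂ ell X H Θ los W) (i : ℕ) :
    ∀ᵐ ω ∂μ, ‖point3D X H i ω‖ = ‖X i ω‖ / Real.cos (Θ i ω) := by
  filter_upwards [hm.ae_cos_angle_pos i, hm.altitude_eq i] with ω h1 h2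
  rw [norm_point3D, Real.sqrt_eq_iff_mul_self_eq (by positivity) (by positivity)]
  have h3 : H i ω = ‖X i ω‖ * Real.sin (Θ i ω) / Real.cos (Θ i ω) := by
    rw [← h2, mul_div_cancel_right₀ _ h1.ne']
  rw [h3]
  field_simp
  linear_combination ‖X i ω‖ ^ 2 * Real.sin_sq_add_cos_sq (Θ i ω)

end IsAerialModel

theorem theorem1 {Ω : Type*} [MeasurableSpace Ω] (μ : Measure Ω) [IsProbabilityMeasure μ]
    (lam α c₁ c₂ ell : ℝ) (hlam : 0 < lam) (hα : 2 < α) (hc₁ : 0 < c₁) (hc₂ : 0 < c₂)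
    (hell : ell ∈ Set.Icc (0 : ℝ) 1)
    (X : ℕ → Ω → Plane) (H Θ : ℕ → Ω → ℝ) (los : ℕ → Set Ω) (W : ℕ → Ω → ℝ)
    (hmodel : IsAerialModel μ lam c₁ c₂ ell X H Θ los W) :
    (IsAPIL μ X Θ →
      (∀ᵐ ω ∂μ, IsGreatest (Set.range fun i => gain α ell X H los W i ω)
        (Rstar α ell X H los W ω)) ∧
      ∀ r : ℝ, 0 < r →
        cdf (μ.map (Rstar α ell X H los W)) r =
          Real.exp (-(Real.pi * lam * (∫ ω, W 0 ω ^ (2 / α) ∂μ) *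
            omegaConst μ α c₁ c₂ ell (Θ 0) * r ^ (-(2 / α))))) ∧
    (IsAPDL μ X H Θ →
      (∀ᵐ ω ∂μ, IsGreatest (Set.range fun i => gain α ell X H los W i ω)
        (Rstar α ell X H los W ω)) ∧
      ∀ r : ℝ, 0 < r →
        IntegrableOn (OmegaIntegrand μ α c₁ c₂ ell (W 0) (H 0) r) (Set.Ioi 0) ∧
        cdf (μ.map (Rstar α ell X H los W)) r =
          Real.exp (-(Real.pi * lam * OmegaFun μ α c₁ c₂ ell (W 0) (H 0) r))) := by
  have hα0 : 0 < α := by linarith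
  have hW := hmodel.measurable_weight 0
  have hW0 := hmodel.weight_nonneg 0
  have hWint := hmodel.weight_moments (2 / α) (by positivity) 0
  constructor
  · intro hapil
    have hval : ∀ r : ℝ, 0 < r → _ := fun r hr =>
      lintegral_markedExceedProb_div_cos (c₁ := c₁) hW hW0 hWint hα0 hr hell hc₂
        (hmodel.measurable_angle 0) (hmodel.ae_cos_angle_pos 0)
    -- The marks are the angles themselves.
    obtain ⟨h1, h2⟩ := hmodel.isGreatest_and_cdf_of_marks (α := α) (T := fun _ θ => θ)
      (D := fun t θ => t / Real.cos θ) hlam hell.1 hc₂ hmodel.measurable_angle hapil.angle_iid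
      hapil.angle_indep measurable_snd (by fun_prop) (fun i => .of_forall fun ω => rfl)
      hmodel.ae_norm_point3D_eq_div_cos
      (fun r hr => by rw [hval r hr]; exact ENNReal.ofReal_ne_top)
    refine ⟨h1, fun r hr => ?_⟩
    have hE : 0 ≤ ∫ ω, W 0 ω ^ (2 / α) ∂μ := integral_nonneg_of_ae (by
      filter_upwards [hW0] with ω hω using Real.rpow_nonneg hω _)
    have hω : 0 ≤ omegaConst μ α c₁ c₂ ell (Θ 0) := integral_nonneg fun ω =>
      mul_nonneg (sq_nonneg _) (add_nonneg (mul_nonneg (losProb_mem_Icc hc₂ _).1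
        (sub_nonneg.mpr (Real.rpow_le_one hell.1 hell.2 (by positivity))))
        (Real.rpow_nonneg hell.1 _))
    rw [h2 r hr, hval r hr, ENNReal.toReal_ofReal
      (mul_nonneg (mul_nonneg hE hω) (Real.rpow_nonneg hr.le _))]
    congr 1
    ring
  · intro hapdl
    have hfin : ∀ r, 0 < r → ∫⁻ z in Set.Ioi (0 : ℝ), markedExceedProb μ (W 0) (H 0) α c₁ c₂ ell r
        (fun t x => Real.arctan (x / t)) (fun t x => √(t ^ 2 + x ^ 2)) √z ≠ ∞ := fun r hr =>
      lintegral_markedExceedProb_ne_top hW hW0 hWint hα0 hr hell.1 hc₂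
        fun t m => Real.le_sqrt_of_sq_le (le_add_of_nonneg_right (sq_nonneg m))
    have hTm : Measurable fun p : ℝ × ℝ => Real.arctan (p.2 / p.1) := by fun_prop
    have hDm : Measurable fun p : ℝ × ℝ => √(p.1 ^ 2 + p.2 ^ 2) := by fun_prop
    -- The marks are the altitudes; angle and length follow from the right triangle over the ground
    -- projection.
    obtain ⟨h1, h2⟩ := hmodel.isGreatest_and_cdf_of_marks (α := α)
      (T := fun t x => Real.arctan (x / t)) (D := fun t x => √(t ^ 2 + x ^ 2)) hlam hell.1 hc₂
      hmodel.measurable_altitude hapdl.altitude_iid hapdl.altitude_indep hTm hDm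
      hapdl.angle_eq (fun i => .of_forall fun ω => IsAerialModel.norm_point3D i ω) hfin
    refine ⟨h1, fun r hr => ?_⟩
    have heq : ∀ z ∈ Set.Ioi (0 : ℝ), (markedExceedProb μ (W 0) (H 0) α c₁ c₂ ell r
        (fun t x => Real.arctan (x / t)) (fun t x => √(t ^ 2 + x ^ 2)) √z).toReal =
        OmegaIntegrand μ α c₁ c₂ ell (W 0) (H 0) r z := fun z hz => by
      rw [markedExceedProb_arctan_eq hW (hmodel.measurable_altitude 0) hr hell.1 hc₂ hz,
        ENNReal.toReal_ofReal (OmegaIntegrand_nonneg hc₂ _ _)]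
    have hmeas : Measurable fun z : ℝ => markedExceedProb μ (W 0) (H 0) α c₁ c₂ ell r
        (fun t x => Real.arctan (x / t)) (fun t x => √(t ^ 2 + x ^ 2)) √z :=
      (measurable_markedExceedProb hW (hmodel.measurable_altitude 0) hTm hDm).comp
        Real.continuous_sqrt.measurable
    constructor
    · exact IntegrableOn.congr_fun
        (integrable_toReal_of_lintegral_ne_top hmeas.aemeasurable (hfin r hr)) heq
        measurableSet_Ioi
    · rw [h2 r hr, OmegaFun, ← setIntegral_congr_fun measurableSet_Ioi heq,
        integral_toReal hmeas.aemeasurable (ae_lt_top hmeas (hfin r hr))]
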